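/- Let $(M,g)$ be a smooth 4-dimensional Lorentzian manifold of signature $(+,-,-,-)$, let $U\subseteq M$ be open, and let $\{\ell,n,m,\bar m\}$ be a smooth null tetrad on $U$ ($\ell,n$ real, $g(\ell,n)=1$, $g(m,\bar m)=-1$, all other products zero). Tensors are complexified and $\nabla$ is the Levi-Civita connection of $g$. Define the complex-valued almost-complex structure $J_a{}^b=i(\ell_a n^b-n_a\ell^b+\bar m_a m^b-m_a\bar m^b)$, the complex 1-form $f_a=-\tfrac12 J_b{}^c\nabla_cJ_a{}^b$ and the connection $D_XY=\nabla_XY+f(X)Y+f(Y)X-g(X,Y)f^\sharp$. (1) $D$ is a Weyl connection for $g$ on $U$, i.e. it is torsion-free and $D_ag_{bc}=-2f_ag_{bc}$, it satisfies $D_bJ_a{}^b=0$, and it is the only (complex) Weyl connection with this property; the 1-form $f$ is likewise unique. It is called the preferred Weyl connection. (2) If the null directions $\ell$ and $n$ are geodesic and shear-free on $U$, i.e. the spin coefficients $\kappa=g(\nabla_\ell\ell,m)$, $\sigma=g(\nabla_m\ell,m)$, $\kappa'=g(\nabla_nn,\bar m)$, $\sigma'=g(\nabla_{\bar m}n,\bar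 m)$ vanish, then $J$ is parallel, $DJ=0$, and integrable: its Nijenhuis tensor $[X,Y]+J[JX,Y]+J[X,JY]-[JX,JY]$ vanishes. (3) Suppose that on $U$ the metric is Einstein, $R_{ab}=\Lambda g_{ab}$ with $\Lambda\in\mathbb R$ constant, and of Petrov type D with $\ell,n$ along the two repeated principal null directions, i.e. $\Psi_0=\Psi_1=\Psi_3=\Psi_4=0$ and $\Psi_2\ne0$ everywhere on $U$, where $\Psi_2=C_{abcd}\ell^am^b\bar m^cn^d$. Then: - $\kappa=\sigma=\kappa'=\sigma'=0$, and hence $DJ=0$ and $J$ is integrable on $U$; - $f_a=\nabla_a\log\Psi_2^{1/3}$, that is, every point of $U$ has an open neighbourhood $V\subseteq U$ with a smooth branch $L$ of $\log\Psi_2^{1/3}$ on $V$ (so $e^{3L}=\Psi_2$), and $f=dL$ on $V$ for every open $V\subseteq U$ and every such branch; in particular $f$ is closed on $U$; - for every open $V\subseteq U$ and every smooth branch $\Phi$ of $\Psi_2^{2/3}$ on $V$ (a smooth function with $\Phi^3=\Psi_2^2$), $D$ is the Levi-Civita connection on $V$ of the complex metric $\Phi g$, and $(V,\Phi g,J)$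 is Kähler: $\Phi g$ is a smooth symmetric nondegenerate complex bilinear form, $J$ is smooth and integrable with $J^2=-\mathrm{Id}$, $\Phi g(JX,JY)=\Phi g(X,Y)$, and the 2-form $\omega(X,Y)=\Phi g(JX,Y)$ is closed. Thus the spacetime is (locally, on the domain of each branch) conformal, with a generally complex conformal factor, to a Kähler space. -/

import Mathlib

open scoped Manifold ContDiff TensorProduct Topology

noncomputable section

namespace Spacetime

/-- The model space of a 4-dimensional manifold. -/
abbrev E4 : Type := EuclideanSpace ℝ (Fin 4)

section

variable {M : Type*} [TopologicalSpace M] [ChartedSpace E4 M] [IsManifold (𝓡 4) ∞ M]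

/-! ### Complexified tangent vectors and complex vector fields -/

/-- The complexified tangent space `ℂ ⊗ T_x M`. -/
abbrev CTangent (x : M) : Type := ℂ ⊗[ℝ] TangentSpace (𝓡 4) x

/-- Real vector fields (not necessarily smooth). -/
abbrev RField (M : Type*) [TopologicalSpace M] [ChartedSpace E4 M] : Type _ :=
  (x : M) → TangentSpace (𝓡 4) x

/-- Complex vector fields (not necessarily smooth). -/
abbrev CField (M : Type*) [TopologicalSpace M] [ChartedSpace E4 M] : Type _ :=
  (x : M) → CTangent x

/-- Real part of a complexified tangent vector. -/
def reV (x : M) : CTangent x →ₗ[ℝ] TangentSpace (𝓡 4) x :=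
  (TensorProduct.lid ℝ (TangentSpace (𝓡 4) x)).toLinearMap ∘ₗ
    LinearMap.rTensor (TangentSpace (𝓡 4) x) Complex.reLm

/-- Imaginary part of a complexified tangent vector. -/
def imV (x : M) : CTangent x →ₗ[ℝ] TangentSpace (𝓡 4) x :=
  (TensorProduct.lid ℝ (TangentSpace (𝓡 4) x)).toLinearMap ∘ₗ
    LinearMap.rTensor (TangentSpace (𝓡 4) x) Complex.imLm

/-- The complex vector field `P + i Q` with real part `P` and imaginary part `Q`. -/
def mkC (P Q : RField M) : CField M := fun x => (1 : ℂ) ⊗ₜ[ℝ] P x + Complex.I ⊗ₜ[ℝ] Q x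

/-- A real vector field is smooth (`C^∞`) on a neighbourhood of `x`. -/
def RSmoothNear (x : M) (P : RField M) : Prop :=
  ∀ᶠ y in 𝓝 x, ContMDiffAt (𝓡 4) (𝓡 4).tangent ∞
    (fun z => (⟨z, P z⟩ : TangentBundle (𝓡 4) M)) y

/-- A complex vector field is smooth on a neighbourhood of `x`. -/
def VSmoothNear (x : M) (X : CField M) : Prop :=
  RSmoothNear x (fun y => reV y (X y)) ∧ RSmoothNear x (fun y => imV y (X y))

/-- A complex function is smooth on a neighbourhood of `x`. -/
def FSmoothNear (x : M) (φ : M → ℂ) : Prop :=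
  ∀ᶠ y in 𝓝 x, ContMDiffAt (𝓡 4) 𝓘(ℝ, ℂ) ∞ φ y

/-- The differential of a complex function applied to a complexified tangent vector. -/
def dC (φ : M → ℂ) (x : M) (v : CTangent x) : ℂ :=
  let a : ℂ := mfderiv (𝓡 4) 𝓘(ℝ, ℂ) φ x (reV x v)
  let b : ℂ := mfderiv (𝓡 4) 𝓘(ℝ, ℂ) φ x (imV x v)
  a + Complex.I * b

/-- The directional derivative `X(φ)`. -/
def ddir (X : CField M) (φ : M → ℂ) : M → ℂ := fun x => dC φ x (X x)

/-- The Lie bracket of complex vector fields: the complex bilinear extension of the bracket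
of real vector fields. -/
def cbracket (X Y : CField M) : CField M := fun x =>
  (1 : ℂ) ⊗ₜ[ℝ] (VectorField.mlieBracket (𝓡 4) (fun y => reV y (X y)) (fun y => reV y (Y y)) x
      - VectorField.mlieBracket (𝓡 4) (fun y => imV y (X y)) (fun y => imV y (Y y)) x)
  + Complex.I ⊗ₜ[ℝ]
      (VectorField.mlieBracket (𝓡 4) (fun y => reV y (X y)) (fun y => imV y (Y y)) x
      + VectorField.mlieBracket (𝓡 4) (fun y => imV y (X y)) (fun y => reV y (Y y)) x)

/-! ### Metrics, connections -/

/-- A field of complex bilinear forms on the complexified tangent spaces. -/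
abbrev CForm2 (M : Type*) [TopologicalSpace M] [ChartedSpace E4 M] : Type _ :=
  (x : M) → LinearMap.BilinForm ℂ (CTangent x)

/-- A field of complex 1-forms. -/
abbrev CForm1 (M : Type*) [TopologicalSpace M] [ChartedSpace E4 M] : Type _ :=
  (x : M) → CTangent x →ₗ[ℂ] ℂ

/-- A field of endomorphisms of the complexified tangent spaces. -/
abbrev CEnd (M : Type*) [TopologicalSpace M] [ChartedSpace E4 M] : Type _ :=
  (x : M) → CTangent x →ₗ[ℂ] CTangent x

/-- The type of an operator `(X, Y) ↦ D_X Y` on complex vector fields. -/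
abbrev CConn (M : Type*) [TopologicalSpace M] [ChartedSpace E4 M] : Type _ :=
  CField M → CField M → CField M

/-- The function `h(X, Y)`. -/
def ev (h : CForm2 M) (X Y : CField M) : M → ℂ := fun x => h x (X x) (Y x)

/-- The field `J X`. -/
def app (J : CEnd M) (X : CField M) : CField M := fun x => J x (X x)

/-- A smooth Lorentzian metric of signature `(+,-,-,-)`. -/
structure IsLorentzMetric (g : (x : M) → LinearMap.BilinForm ℝ (TangentSpace (𝓡 4) x)) :
    Prop where
  symm : ∀ x u v, g x u v = g x v u
  signature : ∀ x, ∃ b : Module.Basis (Fin 4) ℝ (TangentSpace (𝓡 4) x),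
    ∀ i j, g x (b i) (b j) = if i = j then (if i = 0 then 1 else -1) else 0
  smooth : ∀ x (P Q : RField M), RSmoothNear x P → RSmoothNear x Q →
    ∀ᶠ y in 𝓝 x, ContMDiffAt (𝓡 4) 𝓘(ℝ, ℝ) ∞ (fun z => g z (P z) (Q z)) y

/-- The complex bilinear extension of a real metric. -/
def cmetric (g : (x : M) → LinearMap.BilinForm ℝ (TangentSpace (𝓡 4) x)) : CForm2 M :=
  fun x => LinearMap.BilinForm.baseChange ℂ (g x)

/-- The rescaled complex metric `Φ h`. -/
def rescale (Φ : M → ℂ) (h : CForm2 M) : CForm2 M := fun x => Φ x • h x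

/-- The right-hand side of the Koszul formula. -/
def koszul (h : CForm2 M) (X Y Z : CField M) : M → ℂ := fun x =>
  ddir X (ev h Y Z) x + ddir Y (ev h X Z) x - ddir Z (ev h X Y) x
    + h x (cbracket X Y x) (Z x) - h x (cbracket X Z x) (Y x) - h x (cbracket Y Z x) (X x)

open Classical in
/-- The Levi-Civita derivative `∇_X Y` of `h`: at `x` it is the vector `v` with
`2 h(v, Z) = koszul h X Y Z` for all `Z` (unique when `h` is nondegenerate). -/
def leviCivita (h : CForm2 M) : CConn M := fun X Y x =>
  Classical.epsilon (fun v : CTangent x =>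
    ∀ Z : CField M, VSmoothNear x Z → 2 * h x v (Z x) = koszul h X Y Z x)

/-- `D` is a (complex) affine connection on the open set `U` that is a Weyl connection for `h`
with 1-form `f`: it is torsion-free and `D h = -2 f ⊗ h`. -/
structure IsWeylConnection (U : Set M) (h : CForm2 M) (f : CForm1 M) (D : CConn M) : Prop where
  form_smooth : ∀ x ∈ U, ∀ X, VSmoothNear x X → FSmoothNear x (fun y => f y (X y))
  smooth : ∀ x ∈ U, ∀ X Y, VSmoothNear x X → VSmoothNear x Y → VSmoothNear x (D X Y)
  add_left : ∀ x ∈ U, ∀ X X₁ Y, VSmoothNear x X → VSmoothNear x X₁ → VSmoothNear x Y →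
    D (X + X₁) Y x = D X Y x + D X₁ Y x
  smul_left : ∀ x ∈ U, ∀ (φ : M → ℂ) X Y, FSmoothNear x φ → VSmoothNear x X →
    VSmoothNear x Y → D (fun y => φ y • X y) Y x = φ x • D X Y x
  add_right : ∀ x ∈ U, ∀ X Y Y₁, VSmoothNear x X → VSmoothNear x Y → VSmoothNear x Y₁ →
    D X (Y + Y₁) x = D X Y x + D X Y₁ x
  leibniz : ∀ x ∈ U, ∀ (φ : M → ℂ) X Y, FSmoothNear x φ → VSmoothNear x X →
    VSmoothNear x Y → D X (fun y => φ y • Y y) x = ddir X φ x • Y x + φ x • D X Y x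
  torsion_free : ∀ x ∈ U, ∀ X Y, VSmoothNear x X → VSmoothNear x Y →
    D X Y x - D Y X x = cbracket X Y x
  metric : ∀ x ∈ U, ∀ X Y Z, VSmoothNear x X → VSmoothNear x Y → VSmoothNear x Z →
    ddir X (ev h Y Z) x - h x (D X Y x) (Z x) - h x (Y x) (D X Z x)
      = -2 * f x (X x) * h x (Y x) (Z x)

/-- `D` is the Levi-Civita connection of `h` on `U`: torsion-free with `D h = 0`. -/
def IsLeviCivita (U : Set M) (h : CForm2 M) (D : CConn M) : Prop :=
  IsWeylConnection U h (fun _ => 0) D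

/-- The derivative `(D_X J) Y = D_X (J Y) - J (D_X Y)`. -/
def covJ (D : CConn M) (J : CEnd M) (X Y : CField M) : CField M := fun x =>
  D X (app J Y) x - J x (D X Y x)

/-- `J` is parallel on `U` with respect to `D`. -/
def IsParallel (U : Set M) (D : CConn M) (J : CEnd M) : Prop :=
  ∀ x ∈ U, ∀ X Y, VSmoothNear x X → VSmoothNear x Y → covJ D J X Y x = 0

/-- The Nijenhuis tensor `[X,Y] + J[JX,Y] + J[X,JY] - [JX,JY]`. -/
def nijenhuis (J : CEnd M) (X Y : CField M) : CField M := fun x =>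
  cbracket X Y x + J x (cbracket (app J X) Y x) + J x (cbracket X (app J Y) x)
    - cbracket (app J X) (app J Y) x

/-- `J` is integrable on `U`: its Nijenhuis tensor vanishes there. -/
def IsIntegrable (U : Set M) (J : CEnd M) : Prop :=
  ∀ x ∈ U, ∀ X Y, VSmoothNear x X → VSmoothNear x Y → nijenhuis J X Y x = 0

/-- The 1-form `f` is smooth and closed on `U`. -/
def IsClosedForm1 (U : Set M) (f : CForm1 M) : Prop :=
  (∀ x ∈ U, ∀ X, VSmoothNear x X → FSmoothNear x (fun y => f y (X y))) ∧
  ∀ x ∈ U, ∀ X Y, VSmoothNear x X → VSmoothNear x Y →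
    ddir X (fun y => f y (Y y)) x - ddir Y (fun y => f y (X y)) x - f x (cbracket X Y x) = 0

/-- The Kähler form `ω(X, Y) = h(J X, Y)`. -/
def kahlerForm (h : CForm2 M) (J : CEnd M) : CForm2 M := fun x => (h x).comp (J x) LinearMap.id

/-- The field of bilinear forms `w` is a closed 2-form on `U`: it is alternating and its
exterior derivative vanishes. -/
def IsClosedForm2 (U : Set M) (w : CForm2 M) : Prop :=
  (∀ x ∈ U, ∀ u, w x u u = 0) ∧
  ∀ x ∈ U, ∀ X Y Z, VSmoothNear x X → VSmoothNear x Y → VSmoothNear x Z →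
    ddir X (ev w Y Z) x + ddir Y (ev w Z X) x + ddir Z (ev w X Y) x
      - w x (cbracket X Y x) (Z x) - w x (cbracket Y Z x) (X x)
      - w x (cbracket Z X x) (Y x) = 0

/-- `(U, h, J)` is Kähler: `h` is a smooth complex metric, `J` is a smooth integrable
almost-complex structure compatible with `h`, and the Kähler form is closed. -/
structure IsKahler (U : Set M) (h : CForm2 M) (J : CEnd M) : Prop where
  metric_symm : ∀ x ∈ U, ∀ u v, h x u v = h x v u
  metric_nondegenerate : ∀ x ∈ U, ∀ u, (∀ v, h x u v = 0) → u = 0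
  metric_smooth : ∀ x ∈ U, ∀ X Y, VSmoothNear x X → VSmoothNear x Y →
    FSmoothNear x (ev h X Y)
  almost_complex : ∀ x ∈ U, ∀ u, J x (J x u) = -u
  almost_complex_smooth : ∀ x ∈ U, ∀ X, VSmoothNear x X → VSmoothNear x (app J X)
  compatible : ∀ x ∈ U, ∀ u v, h x (J x u) (J x v) = h x u v
  integrable : IsIntegrable U J
  closed : IsClosedForm2 U (kahlerForm h J)

/-! ### Null tetrads and curvature -/

/-- The matrix `ν` of the metric in a null tetrad (it is its own inverse). -/
def nu : Fin 4 → Fin 4 → ℂ :=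
  ![![0, 1, 0, 0], ![1, 0, 0, 0], ![0, 0, 0, -1], ![0, 0, -1, 0]]

/-- Four real vector fields `ℓ, n, p, q`, from which one forms `m = p + i q`,
`m̄ = p - i q`. -/
structure TetradData (M : Type*) [TopologicalSpace M] [ChartedSpace E4 M] where
  l : RField M
  n : RField M
  p : RField M
  q : RField M

/-- The complex fields `ℓ, n, m, m̄`, numbered `0, 1, 2, 3`. -/
def TetradData.e (T : TetradData M) : Fin 4 → CField M :=
  ![mkC T.l 0, mkC T.n 0, mkC T.p T.q, mkC T.p (-T.q)]

/-- `T` is a smooth null tetrad on `U`: `g(ℓ,n) = 1`, `g(m,m̄) = -1`, and all other products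
vanish. -/
structure IsNullTetrad (U : Set M)
    (g : (x : M) → LinearMap.BilinForm ℝ (TangentSpace (𝓡 4) x)) (T : TetradData M) :
    Prop where
  smooth_l : ∀ x ∈ U, RSmoothNear x T.l
  smooth_n : ∀ x ∈ U, RSmoothNear x T.n
  smooth_p : ∀ x ∈ U, RSmoothNear x T.p
  smooth_q : ∀ x ∈ U, RSmoothNear x T.q
  products : ∀ x ∈ U, ∀ a b, cmetric g x (T.e a x) (T.e b x) = nu a b

/-- The curvature operator `∇_X ∇_Y Z - ∇_Y ∇_X Z - ∇_[X,Y] Z`. -/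
def curvature (D : CConn M) (X Y Z : CField M) : CField M :=
  D X (D Y Z) - D Y (D X Z) - D (cbracket X Y) Z

/-- The tetrad components `R_{abcd}` of the Riemann tensor, with the convention
`(∇_a ∇_b - ∇_b ∇_a) V^d = R_{abc}{}^d V^c`. -/
def riem (h : CForm2 M) (T : TetradData M) (a b c d : Fin 4) : M → ℂ :=
  ev h (curvature (leviCivita h) (T.e a) (T.e b) (T.e c)) (T.e d)

/-- The tetrad components of the Ricci tensor `R_{ab} = R_{acb}{}^c`. -/
def ricci (h : CForm2 M) (T : TetradData M) (a b : Fin 4) : M → ℂ := fun x =>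
  ∑ c, ∑ d, nu c d * riem h T a c b d x

/-- The scalar curvature. -/
def scal (h : CForm2 M) (T : TetradData M) : M → ℂ := fun x =>
  ∑ a, ∑ b, nu a b * ricci h T a b x

/-- The tetrad components of the Weyl tensor. -/
def weyl (h : CForm2 M) (T : TetradData M) (a b c d : Fin 4) : M → ℂ := fun x =>
  riem h T a b c d x
    - (1 / 2) * (nu a c * ricci h T b d x - nu a d * ricci h T b c x
      - nu b c * ricci h T a d x + nu b d * ricci h T a c x)
    + (scal h T x / 6) * (nu a c * nu b d - nu a d * nu b c)

/-- `Ψ₀ = C(ℓ, m, ℓ, m)`. -/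
def Psi0 (h : CForm2 M) (T : TetradData M) : M → ℂ := weyl h T 0 2 0 2

/-- `Ψ₁ = C(ℓ, m, ℓ, n)`. -/
def Psi1 (h : CForm2 M) (T : TetradData M) : M → ℂ := weyl h T 0 2 0 1

/-- `Ψ₂ = C(ℓ, m, m̄, n)`. -/
def Psi2 (h : CForm2 M) (T : TetradData M) : M → ℂ := weyl h T 0 2 3 1

/-- `Ψ₃ = C(ℓ, n, m̄, n)`. -/
def Psi3 (h : CForm2 M) (T : TetradData M) : M → ℂ := weyl h T 0 1 3 1

/-- `Ψ₄ = C(m̄, n, m̄, n)`. -/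
def Psi4 (h : CForm2 M) (T : TetradData M) : M → ℂ := weyl h T 3 1 3 1

/-- Petrov type D on `U`, the tetrad being aligned: `ℓ` and `n` span the two repeated principal
null directions, so that `Ψ₂ ≠ 0` is the only Weyl scalar. -/
def IsTypeD (U : Set M) (h : CForm2 M) (T : TetradData M) : Prop :=
  ∀ x ∈ U, Psi0 h T x = 0 ∧ Psi1 h T x = 0 ∧ Psi2 h T x ≠ 0 ∧ Psi3 h T x = 0 ∧ Psi4 h T x = 0

/-- The Einstein condition `R_{ab} = Λ g_{ab}` on `U`, with cosmological constant `Λ`. -/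
def IsEinstein (U : Set M) (h : CForm2 M) (T : TetradData M) (Λ : ℝ) : Prop :=
  ∀ x ∈ U, ∀ a b, ricci h T a b x = (Λ : ℂ) * nu a b

/-- The spin coefficients `κ = g(∇_ℓ ℓ, m)`, `σ = g(∇_m ℓ, m)`, `κ' = g(∇_n n, m̄)`,
`σ' = g(∇_m̄ n, m̄)` vanish on `U`: the congruences of `ℓ` and of `n` are geodesic and
shear-free. -/
def IsGeodesicShearFree (U : Set M) (h : CForm2 M) (T : TetradData M) : Prop :=
  ∀ x ∈ U, ev h (leviCivita h (T.e 0) (T.e 0)) (T.e 2) x = 0 ∧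
    ev h (leviCivita h (T.e 2) (T.e 0)) (T.e 2) x = 0 ∧
    ev h (leviCivita h (T.e 1) (T.e 1)) (T.e 3) x = 0 ∧
    ev h (leviCivita h (T.e 3) (T.e 1)) (T.e 3) x = 0

/-! ### The almost-complex structure of a null tetrad and its Weyl connection -/

/-- `J X = i (g(ℓ,X) n - g(n,X) ℓ + g(m̄,X) m - g(m,X) m̄)`. -/
def tetradJ (h : CForm2 M) (T : TetradData M) : CEnd M := fun x =>
  Complex.I • ((h x (T.e 0 x)).smulRight (T.e 1 x) - (h x (T.e 1 x)).smulRight (T.e 0 x)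
    + (h x (T.e 3 x)).smulRight (T.e 2 x) - (h x (T.e 2 x)).smulRight (T.e 3 x))

/-- The divergence `(D_b J)_a{}^b X^a`, the trace of `V ↦ (D_V J) X`. -/
def divJ (h : CForm2 M) (T : TetradData M) (D : CConn M) (J : CEnd M) (X : CField M) : M → ℂ :=
  fun x => ∑ a, ∑ b, nu a b * ev h (covJ D J (T.e a) X) (T.e b) x

/-- The components `f(X) = -(1/2) J_b{}^c (∇_c J)_a{}^b X^a`, i.e. minus one half of the trace of
`V ↦ (∇_{JV} J) X`, where `∇` is the Levi-Civita connection. -/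
def preferredComp (h : CForm2 M) (T : TetradData M) (J : CEnd M) (X : CField M) : M → ℂ :=
  fun x => -(1 / 2) *
    ∑ a, ∑ b, nu a b * ev h (covJ (leviCivita h) J (app J (T.e a)) X) (T.e b) x

/-- The preferred 1-form `f_a = -(1/2) J_b{}^c ∇_c J_a{}^b`, assembled from its components in
the tetrad: `f(v) = ∑ f(e_a) ν^{ab} h(e_b, v)`. -/
def preferredForm (h : CForm2 M) (T : TetradData M) : CForm1 M := fun x =>
  ∑ a, ∑ b, (preferredComp h T (tetradJ h T) (T.e a) x * nu a b) • h x (T.e b x)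

/-- The connection `∇_X Y + f(X) Y + f(Y) X - h(X,Y) f^♯`, where `∇` is the Levi-Civita
connection and `f^♯ = ∑ ν^{ab} f(e_a) e_b`. -/
def weylConn (h : CForm2 M) (T : TetradData M) (f : CForm1 M) : CConn M := fun X Y x =>
  leviCivita h X Y x + f x (X x) • Y x + f x (Y x) • X x
    - h x (X x) (Y x) • ∑ a, ∑ b, (nu a b * f x (T.e a x)) • T.e b x

/-- The preferred Weyl connection of a null tetrad. -/
def preferredConn (h : CForm2 M) (T : TetradData M) : CConn M :=
  weylConn h T (preferredForm h T)

end

end Spacetime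

end

noncomputable section

namespace Spacetime

section

variable {M : Type*} [TopologicalSpace M] [ChartedSpace E4 M]

theorem minSmoothness_two_le : minSmoothness ℝ 2 ≤ (∞ : WithTop ℕ∞) := by
  rw [minSmoothness_of_isRCLikeNormedField]
  exact WithTop.coe_le_coe.2 (le_top : (2 : ℕ∞) ≤ ⊤)

theorem minSmoothness_three_le : minSmoothness ℝ 3 ≤ (∞ : WithTop ℕ∞) := by
  rw [minSmoothness_of_isRCLikeNormedField]
  exact WithTop.coe_le_coe.2 (le_top : (3 : ℕ∞) ≤ ⊤)

/-! ### Real and imaginary parts -/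

@[simp] theorem reV_tmul (x : M) (a : ℂ) (v : TangentSpace (𝓡 4) x) :
    reV x (a ⊗ₜ[ℝ] v) = a.re • v := by
  simp [reV]

@[simp] theorem imV_tmul (x : M) (a : ℂ) (v : TangentSpace (𝓡 4) x) :
    imV x (a ⊗ₜ[ℝ] v) = a.im • v := by
  simp [imV]

theorem tmul_reV_add (x : M) (u : CTangent x) :
    (1 : ℂ) ⊗ₜ[ℝ] reV x u + Complex.I ⊗ₜ[ℝ] imV x u = u := by
  induction u using TensorProduct.induction_on with
  | zero => simp
  | tmul a v =>
    simp only [reV_tmul, imV_tmul, TensorProduct.tmul_smul, TensorProduct.smul_tmul',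
      ← TensorProduct.add_tmul]
    congr 1
    apply Complex.ext <;> simp
  | add u v hu hv =>
    conv_rhs => rw [← hu, ← hv]
    simp only [map_add, TensorProduct.tmul_add]
    abel

theorem cTangent_ext {x : M} {u v : CTangent x} (hr : reV x u = reV x v)
    (hi : imV x u = imV x v) : u = v := by
  rw [← tmul_reV_add x u, ← tmul_reV_add x v, hr, hi]

@[simp] theorem reV_smul (x : M) (c : ℂ) (u : CTangent x) :
    reV x (c • u) = c.re • reV x u - c.im • imV x u := by
  induction u using TensorProduct.induction_on with
  | zero => simp
  | tmul a v => simp [TensorProduct.smul_tmul', sub_smul, mul_smul]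
  | add u v hu hv => simp only [smul_add, map_add, hu, hv]; abel

@[simp] theorem imV_smul (x : M) (c : ℂ) (u : CTangent x) :
    imV x (c • u) = c.re • imV x u + c.im • reV x u := by
  induction u using TensorProduct.induction_on with
  | zero => simp
  | tmul a v => simp [TensorProduct.smul_tmul', add_smul, mul_smul]
  | add u v hu hv => simp only [smul_add, map_add, hu, hv]; abel

@[simp] theorem reV_mkC (P Q : RField M) (x : M) : reV x (mkC P Q x) = P x := by simp [mkC]

@[simp] theorem imV_mkC (P Q : RField M) (x : M) : imV x (mkC P Q x) = Q x := by simp [mkC]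

/-! ### Smooth functions -/

theorem FSmoothNear.eventually {x : M} {φ : M → ℂ} (h : FSmoothNear x φ) :
    ∀ᶠ y in 𝓝 x, FSmoothNear y φ := eventually_eventually_nhds.2 h

theorem FSmoothNear.congr {x : M} {φ ψ : M → ℂ} (h : FSmoothNear x φ) (he : φ =ᶠ[𝓝 x] ψ) :
    FSmoothNear x ψ := by
  filter_upwards [h, he.eventuallyEq_nhds] with y hy hey
  exact hy.congr_of_eventuallyEq hey.symm

theorem FSmoothNear.const (x : M) (c : ℂ) : FSmoothNear x (fun _ => c) :=
  Filter.Eventually.of_forall fun _ => contMDiffAt_const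

theorem FSmoothNear.add {x : M} {φ ψ : M → ℂ} (h : FSmoothNear x φ) (h' : FSmoothNear x ψ) :
    FSmoothNear x (fun y => φ y + ψ y) := by
  filter_upwards [h, h'] with y hy hy' using hy.add hy'

theorem FSmoothNear.mul {x : M} {φ ψ : M → ℂ} (h : FSmoothNear x φ) (h' : FSmoothNear x ψ) :
    FSmoothNear x (fun y => φ y * ψ y) := by
  filter_upwards [h, h'] with y hy hy'
  exact (contDiff_mul (𝕜 := ℝ) (𝔸 := ℂ)).contMDiff.contMDiffAt.comp y (hy.prodMk_space hy')

theorem FSmoothNear.neg {x : M} {φ : M → ℂ} (h : FSmoothNear x φ) :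
    FSmoothNear x (fun y => - φ y) := by
  filter_upwards [h] with y hy using hy.neg

theorem FSmoothNear.sub {x : M} {φ ψ : M → ℂ} (h : FSmoothNear x φ) (h' : FSmoothNear x ψ) :
    FSmoothNear x (fun y => φ y - ψ y) := by
  filter_upwards [h, h'] with y hy hy' using hy.sub hy'

theorem FSmoothNear.sum {ι : Type*} {s : Finset ι} {x : M} {φ : ι → M → ℂ}
    (h : ∀ i ∈ s, FSmoothNear x (φ i)) : FSmoothNear x (fun y => ∑ i ∈ s, φ i y) := by
  classical
  induction s using Finset.induction_on with
  | empty => simpa using FSmoothNear.const x 0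
  | insert i s hi ih =>
    simp only [Finset.sum_insert hi]
    exact (h i (by simp)).add (ih fun j hj => h j (by simp [hj]))

theorem FSmoothNear.mdifferentiableAt {x : M} {φ : M → ℂ} (h : FSmoothNear x φ) :
    MDifferentiableAt (𝓡 4) 𝓘(ℝ, ℂ) φ x :=
  h.self_of_nhds.mdifferentiableAt (by simp)

/-- A real function is smooth on a neighbourhood of `x`. -/
def RFSmoothNear (x : M) (φ : M → ℝ) : Prop :=
  ∀ᶠ y in 𝓝 x, ContMDiffAt (𝓡 4) 𝓘(ℝ, ℝ) ∞ φ y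

theorem RFSmoothNear.mdifferentiableAt {x : M} {φ : M → ℝ} (h : RFSmoothNear x φ) :
    MDifferentiableAt (𝓡 4) 𝓘(ℝ, ℝ) φ x :=
  h.self_of_nhds.mdifferentiableAt (by simp)

theorem FSmoothNear.re {x : M} {φ : M → ℂ} (h : FSmoothNear x φ) :
    RFSmoothNear x (fun y => (φ y).re) := by
  filter_upwards [h] with y hy
  exact (Complex.reCLM.contDiff.contMDiff.contMDiffAt).comp y hy

theorem FSmoothNear.im {x : M} {φ : M → ℂ} (h : FSmoothNear x φ) :
    RFSmoothNear x (fun y => (φ y).im) := by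
  filter_upwards [h] with y hy
  exact (Complex.imCLM.contDiff.contMDiff.contMDiffAt).comp y hy

theorem RFSmoothNear.ofReal {x : M} {φ : M → ℝ} (h : RFSmoothNear x φ) :
    FSmoothNear x (fun y => (φ y : ℂ)) := by
  filter_upwards [h] with y hy
  exact (Complex.ofRealCLM.contDiff.contMDiff.contMDiffAt).comp y hy

/-! ### Differentials -/

theorem dC_eq (φ : M → ℂ) (x : M) (v : CTangent x) :
    dC φ x v = mvfderiv (𝓡 4) φ x (reV x v) + Complex.I * mvfderiv (𝓡 4) φ x (imV x v) := rfl

theorem dC_vec_add (φ : M → ℂ) (x : M) (u v : CTangent x) :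
    dC φ x (u + v) = dC φ x u + dC φ x v := by
  simp only [dC_eq, map_add]; ring

theorem dC_vec_smul (φ : M → ℂ) (x : M) (c : ℂ) (v : CTangent x) :
    dC φ x (c • v) = c * dC φ x v := by
  simp only [dC_eq, reV_smul, imV_smul, map_add, map_sub, map_smul, Complex.real_smul]
  have hI := Complex.I_mul_I
  have hc := Complex.re_add_im c
  generalize (c.re : ℂ) = p at *
  generalize (c.im : ℂ) = q at *
  subst hc
  linear_combination (-q * (mvfderiv (𝓡 4) φ x (imV x v))) * hI

/-- The differential of a complex function as a complex linear form. -/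
def dL (φ : M → ℂ) (x : M) : CTangent x →ₗ[ℂ] ℂ where
  toFun := dC φ x
  map_add' := dC_vec_add φ x
  map_smul' := dC_vec_smul φ x

theorem dC_congr {x : M} {φ ψ : M → ℂ} (h : φ =ᶠ[𝓝 x] ψ) (v : CTangent x) :
    dC φ x v = dC ψ x v := by
  simp only [dC_eq, mvfderiv]
  rw [h.mfderiv_eq]
  simp
  rfl

theorem dC_const (x : M) (c : ℂ) (v : CTangent x) : dC (fun _ => c) x v = 0 := by
  simp [dC_eq, mvfderiv_const]

theorem dC_add {x : M} {φ ψ : M → ℂ} (h : FSmoothNear x φ) (h' : FSmoothNear x ψ)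
    (v : CTangent x) : dC (fun y => φ y + ψ y) x v = dC φ x v + dC ψ x v := by
  have := mvfderiv_add h.mdifferentiableAt h'.mdifferentiableAt
  simp only [dC_eq]
  erw [this]
  simp only [add_apply]
  ring

theorem dC_mul {x : M} {φ ψ : M → ℂ} (h : FSmoothNear x φ) (h' : FSmoothNear x ψ)
    (v : CTangent x) : dC (fun y => φ y * ψ y) x v = φ x * dC ψ x v + ψ x * dC φ x v := by
  have key : ∀ w : TangentSpace (𝓡 4) x, mvfderiv (𝓡 4) (fun y => φ y * ψ y) x w
      = φ x * mvfderiv (𝓡 4) ψ x w + ψ x * mvfderiv (𝓡 4) φ x w := by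
    intro w
    have := (h.mdifferentiableAt.hasMFDerivAt.mul h'.mdifferentiableAt.hasMFDerivAt).mfderiv
    change (mfderiv (𝓡 4) 𝓘(ℝ, ℂ) (φ * ψ) x) w = _
    rw [this]
    rfl
  simp only [dC_eq, key]
  ring

theorem dC_neg {x : M} {φ : M → ℂ} (h : FSmoothNear x φ) (v : CTangent x) :
    dC (fun y => - φ y) x v = - dC φ x v := by
  have := dC_mul (FSmoothNear.const x (-1)) h v
  simpa [dC_const] using this

theorem dC_const_mul {x : M} {φ : M → ℂ} (c : ℂ) (h : FSmoothNear x φ) (v : CTangent x) :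
    dC (fun y => c * φ y) x v = c * dC φ x v := by
  simpa [dC_const] using dC_mul (FSmoothNear.const x c) h v

theorem dC_sub {x : M} {φ ψ : M → ℂ} (h : FSmoothNear x φ) (h' : FSmoothNear x ψ)
    (v : CTangent x) : dC (fun y => φ y - ψ y) x v = dC φ x v - dC ψ x v := by
  simpa [sub_eq_add_neg, dC_neg h'] using dC_add h h'.neg v

theorem dC_sum {ι : Type*} {s : Finset ι} {x : M} {φ : ι → M → ℂ}
    (h : ∀ i ∈ s, FSmoothNear x (φ i)) (v : CTangent x) :
    dC (fun y => ∑ i ∈ s, φ i y) x v = ∑ i ∈ s, dC (φ i) x v := by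
  classical
  induction s using Finset.induction_on with
  | empty => simp [dC_const]
  | insert i s hi ih =>
    simp only [Finset.sum_insert hi]
    rw [dC_add (h i (by simp)) (.sum fun j hj => h j (by simp [hj])),
      ih fun j hj => h j (by simp [hj])]

/-! ### Smooth real vector fields -/

theorem RSmoothNear.eventually {x : M} {P : RField M} [IsManifold (𝓡 4) ∞ M]
    (h : RSmoothNear x P) : ∀ᶠ y in 𝓝 x, RSmoothNear y P := eventually_eventually_nhds.2 h

variable [IsManifold (𝓡 4) ∞ M]

theorem RSmoothNear.congr {x : M} {P Q : RField M} (h : RSmoothNear x P) (he : P =ᶠ[𝓝 x] Q) :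
    RSmoothNear x Q := by
  filter_upwards [h, he.eventuallyEq_nhds] with y hy hey
  refine hy.congr_of_eventuallyEq ?_
  filter_upwards [hey] with z hz
  rw [hz]

theorem RSmoothNear.add {x : M} {P Q : RField M} (h : RSmoothNear x P) (h' : RSmoothNear x Q) :
    RSmoothNear x (P + Q) := by
  filter_upwards [h, h'] with y hy hy' using hy.add_section hy'

theorem RSmoothNear.neg {x : M} {P : RField M} (h : RSmoothNear x P) : RSmoothNear x (-P) := by
  filter_upwards [h] with y hy using hy.neg_section

theorem RSmoothNear.sub {x : M} {P Q : RField M} (h : RSmoothNear x P) (h' : RSmoothNear x Q) :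
    RSmoothNear x (P - Q) := by
  filter_upwards [h, h'] with y hy hy' using hy.sub_section hy'

theorem RSmoothNear.smul {x : M} {φ : M → ℝ} {P : RField M} (h : RFSmoothNear x φ)
    (h' : RSmoothNear x P) : RSmoothNear x (φ • P) := by
  filter_upwards [h, h'] with y hy hy' using hy.smul_section hy'

theorem RSmoothNear.bracket {x : M} {P Q : RField M} (h : RSmoothNear x P)
    (h' : RSmoothNear x Q) : RSmoothNear x (VectorField.mlieBracket (𝓡 4) P Q) := by
  have : IsManifold (𝓡 4) ((⊤ : ℕ∞) + 1) M := by simpa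
  have : IsManifold (𝓡 4) (minSmoothness ℝ 2) M :=
    .of_le (n := ∞) minSmoothness_two_le
  filter_upwards [h, h'] with y hy hy'
  exact ContMDiffAt.mlieBracket_vectorField (m := ⊤) (n := ⊤) hy hy' (by simp)

theorem RSmoothNear.zero (x : M) : RSmoothNear x (0 : RField M) := by
  refine Filter.Eventually.of_forall fun y => ?_
  exact Bundle.contMDiff_zeroSection ℝ (TangentSpace (𝓡 4) : M → Type _) y

theorem RSmoothNear.mdifferentiableAt {x : M} {P : RField M} (h : RSmoothNear x P) :
    MDifferentiableAt (𝓡 4) (𝓡 4).tangent (fun z => (⟨z, P z⟩ : TangentBundle (𝓡 4) M)) x :=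
  h.self_of_nhds.mdifferentiableAt (by simp)

end

section

variable {M : Type*} [TopologicalSpace M] [ChartedSpace E4 M]

/-- Real part of a complex vector field. -/
def reF (X : CField M) : RField M := fun y => reV y (X y)

/-- Imaginary part of a complex vector field. -/
def imF (X : CField M) : RField M := fun y => imV y (X y)

theorem cField_ext {X Y : CField M} (hr : reF X = reF Y) (hi : imF X = imF Y) : X = Y :=
  funext fun y => cTangent_ext (congrFun hr y) (congrFun hi y)

theorem reF_add (X Y : CField M) : reF (X + Y) = reF X + reF Y := by ext1 y; simp [reF]

theorem imF_add (X Y : CField M) : imF (X + Y) = imF X + imF Y := by ext1 y; simp [imF]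

theorem reF_smul (φ : M → ℂ) (X : CField M) :
    reF (fun y => φ y • X y) = (fun y => (φ y).re) • reF X - (fun y => (φ y).im) • imF X := by
  ext1 y; simp [reF, imF]

theorem imF_smul (φ : M → ℂ) (X : CField M) :
    imF (fun y => φ y • X y) = (fun y => (φ y).re) • imF X + (fun y => (φ y).im) • reF X := by
  ext1 y; simp [reF, imF]

theorem reF_mkC (P Q : RField M) : reF (mkC P Q) = P := by ext1 y; simp [reF]

theorem imF_mkC (P Q : RField M) : imF (mkC P Q) = Q := by ext1 y; simp [imF]

theorem reF_cbracket (X Y : CField M) : reF (cbracket X Y)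
    = VectorField.mlieBracket (𝓡 4) (reF X) (reF Y)
      - VectorField.mlieBracket (𝓡 4) (imF X) (imF Y) := by
  ext1 y; simp only [reF, cbracket, map_add, reV_tmul]; simp; rfl

theorem imF_cbracket (X Y : CField M) : imF (cbracket X Y)
    = VectorField.mlieBracket (𝓡 4) (reF X) (imF Y)
      + VectorField.mlieBracket (𝓡 4) (imF X) (reF Y) := by
  ext1 y; simp only [imF, cbracket, map_add, imV_tmul]; simp; rfl

theorem mvfderiv_apply_eq {x : M} {φ : M → ℂ} (h : FSmoothNear x φ) (v : TangentSpace (𝓡 4) x) :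
    mvfderiv (𝓡 4) φ x v = (mvfderiv (𝓡 4) (fun y => (φ y).re) x v : ℂ)
      + Complex.I * (mvfderiv (𝓡 4) (fun y => (φ y).im) x v : ℂ) := by
  have hr := (Complex.reCLM.hasMFDerivAt (x := φ x)).comp x h.mdifferentiableAt.hasMFDerivAt
  have hi := (Complex.imCLM.hasMFDerivAt (x := φ x)).comp x h.mdifferentiableAt.hasMFDerivAt
  have h1 : mvfderiv (𝓡 4) (fun y => (φ y).re) x v = (mvfderiv (𝓡 4) φ x v).re := by
    change mfderiv (𝓡 4) 𝓘(ℝ, ℝ) (Complex.reCLM ∘ φ) x v = _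
    rw [hr.mfderiv]; rfl
  have h2 : mvfderiv (𝓡 4) (fun y => (φ y).im) x v = (mvfderiv (𝓡 4) φ x v).im := by
    change mfderiv (𝓡 4) 𝓘(ℝ, ℝ) (Complex.imCLM ∘ φ) x v = _
    rw [hi.mfderiv]; rfl
  rw [h1, h2]
  conv_lhs => rw [← Complex.re_add_im (mvfderiv (𝓡 4) φ x v)]
  ring

theorem cbracket_swap (X Y : CField M) : cbracket X Y = - cbracket Y X := by
  apply cField_ext <;> ext1 y
  · change reF (cbracket X Y) y = reV y (-cbracket Y X y)
    rw [map_neg]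
    change _ = - reF (cbracket Y X) y
    simp only [reF_cbracket, Pi.sub_apply]
    rw [VectorField.mlieBracket_swap_apply, VectorField.mlieBracket_swap_apply (V := imF X)]
    abel
  · change imF (cbracket X Y) y = imV y (-cbracket Y X y)
    rw [map_neg]
    change _ = - imF (cbracket Y X) y
    simp only [imF_cbracket, Pi.add_apply]
    rw [VectorField.mlieBracket_swap_apply, VectorField.mlieBracket_swap_apply (V := imF X)]
    abel

theorem cbracket_congr {x : M} {X X₁ Y Y₁ : CField M} (h : ∀ᶠ y in 𝓝 x, X y = X₁ y)
    (h' : ∀ᶠ y in 𝓝 x, Y y = Y₁ y) : cbracket X Y x = cbracket X₁ Y₁ x := by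
  have hr : ∀ {Z Z₁ : CField M}, (∀ᶠ y in 𝓝 x, Z y = Z₁ y) → reF Z =ᶠ[𝓝 x] reF Z₁ := fun h => by
    filter_upwards [h] with y hy; exact congrArg (reV y) hy
  have hi : ∀ {Z Z₁ : CField M}, (∀ᶠ y in 𝓝 x, Z y = Z₁ y) → imF Z =ᶠ[𝓝 x] imF Z₁ := fun h => by
    filter_upwards [h] with y hy; exact congrArg (imV y) hy
  apply cTangent_ext
  · change reF (cbracket X Y) x = reF (cbracket X₁ Y₁) x
    simp only [reF_cbracket, Pi.sub_apply]
    rw [(hr h).mlieBracket_vectorField_eq (hr h'), (hi h).mlieBracket_vectorField_eq (hi h')]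
  · change imF (cbracket X Y) x = imF (cbracket X₁ Y₁) x
    simp only [imF_cbracket, Pi.add_apply]
    rw [(hr h).mlieBracket_vectorField_eq (hi h'), (hi h).mlieBracket_vectorField_eq (hr h')]

variable [IsManifold (𝓡 4) ∞ M]

/-! ### Smooth complex vector fields -/

theorem vSmoothNear_iff {x : M} {X : CField M} :
    VSmoothNear x X ↔ RSmoothNear x (reF X) ∧ RSmoothNear x (imF X) := Iff.rfl

theorem VSmoothNear.re {x : M} {X : CField M} (h : VSmoothNear x X) : RSmoothNear x (reF X) := h.1

theorem VSmoothNear.im {x : M} {X : CField M} (h : VSmoothNear x X) : RSmoothNear x (imF X) := h.2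

theorem VSmoothNear.eventually {x : M} {X : CField M} (h : VSmoothNear x X) :
    ∀ᶠ y in 𝓝 x, VSmoothNear y X := by
  filter_upwards [h.1.eventually, h.2.eventually] with y hy hy' using ⟨hy, hy'⟩

theorem VSmoothNear.congr {x : M} {X Y : CField M} (h : VSmoothNear x X) (he : ∀ᶠ y in 𝓝 x, X y = Y y) :
    VSmoothNear x Y := by
  refine ⟨h.re.congr ?_, h.im.congr ?_⟩ <;> filter_upwards [he] with y hy
  exacts [congrArg (reV y) hy, congrArg (imV y) hy]

theorem VSmoothNear.add {x : M} {X Y : CField M} (h : VSmoothNear x X) (h' : VSmoothNear x Y) :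
    VSmoothNear x (X + Y) := by
  rw [vSmoothNear_iff, reF_add, imF_add]
  exact ⟨h.re.add h'.re, h.im.add h'.im⟩

theorem VSmoothNear.smul {x : M} {φ : M → ℂ} {X : CField M} (h : FSmoothNear x φ)
    (h' : VSmoothNear x X) : VSmoothNear x (fun y => φ y • X y) := by
  rw [vSmoothNear_iff, reF_smul, imF_smul]
  exact ⟨(h'.re.smul h.re).sub (h'.im.smul h.im), (h'.im.smul h.re).add (h'.re.smul h.im)⟩

theorem VSmoothNear.neg {x : M} {X : CField M} (h : VSmoothNear x X) : VSmoothNear x (-X) := by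
  have := VSmoothNear.smul (FSmoothNear.const x (-1)) h
  simpa [Pi.neg_def] using this

theorem VSmoothNear.sub {x : M} {X Y : CField M} (h : VSmoothNear x X) (h' : VSmoothNear x Y) :
    VSmoothNear x (X - Y) := by
  rw [sub_eq_add_neg]; exact h.add h'.neg

theorem VSmoothNear.mkC {x : M} {P Q : RField M} (h : RSmoothNear x P) (h' : RSmoothNear x Q) :
    VSmoothNear x (mkC P Q) := by
  rw [vSmoothNear_iff, reF_mkC, imF_mkC]
  exact ⟨h, h'⟩

theorem VSmoothNear.zero (x : M) : VSmoothNear x (0 : CField M) := by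
  have : (0 : CField M) = Spacetime.mkC (0 : RField M) 0 := by
    apply cField_ext <;> ext1 y <;> simp [reF, imF]
  rw [this]
  exact .mkC (.zero x) (.zero x)

theorem VSmoothNear.sum {ι : Type*} {s : Finset ι} {x : M} {X : ι → CField M}
    (h : ∀ i ∈ s, VSmoothNear x (X i)) : VSmoothNear x (fun y => ∑ i ∈ s, X i y) := by
  classical
  induction s using Finset.induction_on with
  | empty => simpa using! VSmoothNear.zero x
  | insert i s hi ih =>
    simp only [Finset.sum_insert hi]
    exact (h i (by simp)).add (ih fun j hj => h j (by simp [hj]))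

/-! ### The complex Lie bracket -/

theorem VSmoothNear.cbracket {x : M} {X Y : CField M} (h : VSmoothNear x X)
    (h' : VSmoothNear x Y) : VSmoothNear x (cbracket X Y) := by
  rw [vSmoothNear_iff, reF_cbracket, imF_cbracket]
  exact ⟨(h.re.bracket h'.re).sub (h.im.bracket h'.im), (h.re.bracket h'.im).add (h.im.bracket h'.re)⟩

theorem mlieBracket_sub_right {x : M} {P Q R : RField M} (hQ : RSmoothNear x Q)
    (hR : RSmoothNear x R) : VectorField.mlieBracket (𝓡 4) P (Q - R) x
      = VectorField.mlieBracket (𝓡 4) P Q x - VectorField.mlieBracket (𝓡 4) P R x := by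
  have hn : -R = (fun _ : M => (-1 : ℝ)) • R := by ext1 y; simp
  rw [sub_eq_add_neg, VectorField.mlieBracket_add_right hQ.mdifferentiableAt
    hR.neg.mdifferentiableAt, hn, VectorField.mlieBracket_smul_right mdifferentiableAt_const
    hR.mdifferentiableAt]
  simp [mvfderiv_const, sub_eq_add_neg]

theorem cbracket_add_right {x : M} {X Y Y₁ : CField M} (h : VSmoothNear x Y)
    (h' : VSmoothNear x Y₁) : cbracket X (Y + Y₁) x = cbracket X Y x + cbracket X Y₁ x := by
  apply cTangent_ext
  · rw [map_add]
    change reF (cbracket X (Y + Y₁)) x = reF (cbracket X Y) x + reF (cbracket X Y₁) x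
    simp only [reF_cbracket, Pi.sub_apply, reF_add, imF_add]
    rw [VectorField.mlieBracket_add_right h.re.mdifferentiableAt h'.re.mdifferentiableAt,
      VectorField.mlieBracket_add_right h.im.mdifferentiableAt h'.im.mdifferentiableAt]
    abel
  · rw [map_add]
    change imF (cbracket X (Y + Y₁)) x = imF (cbracket X Y) x + imF (cbracket X Y₁) x
    simp only [imF_cbracket, Pi.add_apply, reF_add, imF_add]
    rw [VectorField.mlieBracket_add_right h.re.mdifferentiableAt h'.re.mdifferentiableAt,
      VectorField.mlieBracket_add_right h.im.mdifferentiableAt h'.im.mdifferentiableAt]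
    abel

theorem cbracket_add_left {x : M} {X X₁ Y : CField M} (h : VSmoothNear x X)
    (h' : VSmoothNear x X₁) : cbracket (X + X₁) Y x = cbracket X Y x + cbracket X₁ Y x := by
  rw [cbracket_swap, Pi.neg_apply, cbracket_add_right h h', cbracket_swap X, cbracket_swap X₁]
  simp only [Pi.neg_apply]; abel

theorem cbracket_smul_right {x : M} {X Y : CField M} {φ : M → ℂ} (hφ : FSmoothNear x φ)
    (h : VSmoothNear x Y) : cbracket X (fun y => φ y • Y y) x
      = ddir X φ x • Y x + φ x • cbracket X Y x := by
  have e1 := VectorField.mlieBracket_smul_right (V := reF X) hφ.re.mdifferentiableAt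
    h.re.mdifferentiableAt
  have e2 := VectorField.mlieBracket_smul_right (V := reF X) hφ.im.mdifferentiableAt
    h.re.mdifferentiableAt
  have e3 := VectorField.mlieBracket_smul_right (V := reF X) hφ.re.mdifferentiableAt
    h.im.mdifferentiableAt
  have e4 := VectorField.mlieBracket_smul_right (V := reF X) hφ.im.mdifferentiableAt
    h.im.mdifferentiableAt
  have f1 := VectorField.mlieBracket_smul_right (V := imF X) hφ.re.mdifferentiableAt
    h.re.mdifferentiableAt
  have f2 := VectorField.mlieBracket_smul_right (V := imF X) hφ.im.mdifferentiableAt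
    h.re.mdifferentiableAt
  have f3 := VectorField.mlieBracket_smul_right (V := imF X) hφ.re.mdifferentiableAt
    h.im.mdifferentiableAt
  have f4 := VectorField.mlieBracket_smul_right (V := imF X) hφ.im.mdifferentiableAt
    h.im.mdifferentiableAt
  have hre : (ddir X φ x).re = mvfderiv (𝓡 4) (fun y => (φ y).re) x (reF X x)
      - mvfderiv (𝓡 4) (fun y => (φ y).im) x (imF X x) := by
    simp only [ddir, dC_eq, mvfderiv_apply_eq hφ]; simp [reF, imF, sub_eq_add_neg]
  have him : (ddir X φ x).im = mvfderiv (𝓡 4) (fun y => (φ y).im) x (reF X x)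
      + mvfderiv (𝓡 4) (fun y => (φ y).re) x (imF X x) := by
    simp only [ddir, dC_eq, mvfderiv_apply_eq hφ]; simp [reF, imF]
  have g1 : reV x (cbracket X Y x) = _ := congrFun (reF_cbracket X Y) x
  have g2 : imV x (cbracket X Y x) = _ := congrFun (imF_cbracket X Y) x
  have k1 := fun P : RField M => mlieBracket_sub_right (P := P) (h.re.smul hφ.re) (h.im.smul hφ.im)
  have k2 := fun P : RField M => VectorField.mlieBracket_add_right (V := P)
    (h.im.smul hφ.re).mdifferentiableAt (h.re.smul hφ.im).mdifferentiableAt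
  apply cTangent_ext
  · rw [map_add, reV_smul, reV_smul, hre, him, g1, g2]
    change reF (cbracket X (fun y => φ y • Y y)) x = _
    simp only [reF_cbracket, reF_smul, imF_smul, Pi.sub_apply, Pi.add_apply]
    rw [k1, k2, e1, e4, f3, f2]
    change _ = (_ • reF Y x - _ • imF Y x) + _
    module
  · rw [map_add, imV_smul, imV_smul, hre, him, g1, g2]
    change imF (cbracket X (fun y => φ y • Y y)) x = _
    simp only [imF_cbracket, reF_smul, imF_smul, Pi.sub_apply, Pi.add_apply]
    rw [k1, k2, e3, e2, f1, f4]
    change _ = (_ • imF Y x + _ • reF Y x) + _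
    module

theorem cbracket_smul_left {x : M} {X Y : CField M} {φ : M → ℂ} (hφ : FSmoothNear x φ)
    (h : VSmoothNear x X) : cbracket (fun y => φ y • X y) Y x
      = φ x • cbracket X Y x - ddir Y φ x • X x := by
  rw [cbracket_swap, Pi.neg_apply, cbracket_smul_right hφ h, cbracket_swap X Y, Pi.neg_apply]
  module

theorem mlieBracket_jacobi {x : M} {P Q R : RField M} (hP : RSmoothNear x P)
    (hQ : RSmoothNear x Q) (hR : RSmoothNear x R) :
    VectorField.mlieBracket (𝓡 4) P (VectorField.mlieBracket (𝓡 4) Q R) x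
      = - VectorField.mlieBracket (𝓡 4) R (VectorField.mlieBracket (𝓡 4) P Q) x
      + VectorField.mlieBracket (𝓡 4) Q (VectorField.mlieBracket (𝓡 4) P R) x := by
  have : IsManifold (𝓡 4) (minSmoothness ℝ 3) M :=
    .of_le (n := ∞) minSmoothness_three_le
  rw [VectorField.leibniz_identity_mlieBracket_apply (hP.self_of_nhds.of_le minSmoothness_two_le)
    (hQ.self_of_nhds.of_le minSmoothness_two_le) (hR.self_of_nhds.of_le minSmoothness_two_le),
    VectorField.mlieBracket_swap_apply (V := VectorField.mlieBracket (𝓡 4) P Q)]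

theorem cbracket_jacobi {x : M} {X Y Z : CField M} (hX : VSmoothNear x X)
    (hY : VSmoothNear x Y) (hZ : VSmoothNear x Z) :
    cbracket X (cbracket Y Z) x
      = - cbracket Z (cbracket X Y) x + cbracket Y (cbracket X Z) x := by
  have k1 := fun {A B : CField M} (hA : VSmoothNear x A) (hB : VSmoothNear x B) (P : RField M) =>
    mlieBracket_sub_right (P := P) (hA.re.bracket hB.re) (hA.im.bracket hB.im)
  have k2 := fun {A B : CField M} (hA : VSmoothNear x A) (hB : VSmoothNear x B) (P : RField M) =>
    VectorField.mlieBracket_add_right (V := P) (hA.re.bracket hB.im).mdifferentiableAt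
      (hA.im.bracket hB.re).mdifferentiableAt
  have re_eq : ∀ A B : CField M, reV x (cbracket A B x) = reF (cbracket A B) x := fun _ _ => rfl
  have im_eq : ∀ A B : CField M, imV x (cbracket A B x) = imF (cbracket A B) x := fun _ _ => rfl
  apply cTangent_ext
  · simp only [map_add, map_neg, re_eq, reF_cbracket, imF_cbracket, Pi.sub_apply]
    rw [k1 hY hZ, k2 hY hZ, k1 hX hY, k2 hX hY, k1 hX hZ, k2 hX hZ]
    linear_combination (norm := module) mlieBracket_jacobi hX.re hY.re hZ.re
      - mlieBracket_jacobi hX.re hY.im hZ.im - mlieBracket_jacobi hX.im hY.re hZ.im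
      - mlieBracket_jacobi hX.im hY.im hZ.re
  · simp only [map_add, map_neg, im_eq, reF_cbracket, imF_cbracket, Pi.add_apply]
    rw [k1 hY hZ, k2 hY hZ, k1 hX hY, k2 hX hY, k1 hX hZ, k2 hX hZ]
    linear_combination (norm := module) mlieBracket_jacobi hX.re hY.re hZ.im
      + mlieBracket_jacobi hX.re hY.im hZ.re + mlieBracket_jacobi hX.im hY.re hZ.re
      - mlieBracket_jacobi hX.im hY.im hZ.im

end

section

variable {M : Type*} [TopologicalSpace M] [ChartedSpace E4 M]

theorem nu_symm (a b : Fin 4) : nu a b = nu b a := by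
  fin_cases a <;> fin_cases b <;> rfl

theorem cmetric_tmul (g : (x : M) → LinearMap.BilinForm ℝ (TangentSpace (𝓡 4) x)) (x : M)
    (a b : ℂ) (u v : TangentSpace (𝓡 4) x) :
    cmetric g x (a ⊗ₜ[ℝ] u) (b ⊗ₜ[ℝ] v) = a * b * (g x u v : ℂ) := by
  simp [cmetric, LinearMap.BilinForm.baseChange_tmul, mul_comm, mul_assoc]

theorem cmetric_apply (g : (x : M) → LinearMap.BilinForm ℝ (TangentSpace (𝓡 4) x)) (x : M)
    (u v : CTangent x) :
    cmetric g x u v = ((g x (reV x u) (reV x v) : ℂ) - (g x (imV x u) (imV x v) : ℂ))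
      + Complex.I * ((g x (reV x u) (imV x v) : ℂ) + (g x (imV x u) (reV x v) : ℂ)) := by
  conv_lhs => rw [← tmul_reV_add x u, ← tmul_reV_add x v]
  simp only [map_add, LinearMap.add_apply, cmetric_tmul]
  linear_combination (g x (imV x u) (imV x v) : ℂ) * Complex.I_mul_I

variable [IsManifold (𝓡 4) ∞ M]

/-! ### Null frames of a smooth complex metric -/

/-- `T` is a smooth null frame on the open set `U` for the smooth symmetric complex bilinear
form `h`; the frame spans every complexified tangent space over `U`. -/
structure IsNullFrame (U : Set M) (h : CForm2 M) (T : TetradData M) : Prop where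
  isOpen : IsOpen U
  symm : ∀ x u v, h x u v = h x v u
  smooth : ∀ x X Y, VSmoothNear x X → VSmoothNear x Y → FSmoothNear x (ev h X Y)
  frame_smooth : ∀ x ∈ U, ∀ a, VSmoothNear x (T.e a)
  products : ∀ x ∈ U, ∀ a b, h x (T.e a x) (T.e b x) = nu a b
  expand : ∀ x ∈ U, ∀ v, v = ∑ a, ∑ b, (nu a b * h x (T.e a x) v) • T.e b x

theorem IsLorentzMetric.isNullFrame {g : (x : M) → LinearMap.BilinForm ℝ (TangentSpace (𝓡 4) x)}
    (hg : IsLorentzMetric g) {U : Set M} (hU : IsOpen U) {T : TetradData M}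
    (hT : IsNullTetrad U g T) : IsNullFrame U (cmetric g) T where
  isOpen := hU
  symm x u v := by
    simp only [cmetric_apply, hg.symm x (reV x v), hg.symm x (imV x v)]
    ring
  smooth x X Y hX hY := by
    have h1 : RFSmoothNear x (fun y => g y (reF X y) (reF Y y)) := hg.smooth x _ _ hX.re hY.re
    have h2 : RFSmoothNear x (fun y => g y (imF X y) (imF Y y)) := hg.smooth x _ _ hX.im hY.im
    have h3 : RFSmoothNear x (fun y => g y (reF X y) (imF Y y)) := hg.smooth x _ _ hX.re hY.im
    have h4 : RFSmoothNear x (fun y => g y (imF X y) (reF Y y)) := hg.smooth x _ _ hX.im hY.re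
    have := (h1.ofReal.sub h2.ofReal).add ((FSmoothNear.const x Complex.I).mul
      (h3.ofReal.add h4.ofReal))
    refine this.congr (Filter.Eventually.of_forall fun y => ?_)
    simp only [ev, cmetric_apply]
    rfl
  frame_smooth x hx a := by
    fin_cases a
    · exact .mkC (hT.smooth_l x hx) (.zero x)
    · exact .mkC (hT.smooth_n x hx) (.zero x)
    · exact .mkC (hT.smooth_p x hx) (hT.smooth_q x hx)
    · exact .mkC (hT.smooth_p x hx) (hT.smooth_q x hx).neg
  products := hT.products
  expand x hx v := by
    have hli : LinearIndependent ℂ (fun a => T.e a x) := by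
      rw [Fintype.linearIndependent_iff]
      intro c hc
      have key : ∀ b, ∑ a, c a * nu b a = 0 := fun b => by
        have := congrArg (cmetric g x (T.e b x)) hc
        simpa [hT.products x hx] using this
      have k0 := key 0
      have k1 := key 1
      have k2 := key 2
      have k3 := key 3
      simp [Fin.sum_univ_four, nu] at k0 k1 k2 k3
      intro i
      fin_cases i <;> assumption
    have hfr : Module.finrank ℝ (TangentSpace (𝓡 4) x) = 4 := by
      change Module.finrank ℝ E4 = 4
      simp
    have hcard : Fintype.card (Fin 4) = Module.finrank ℂ (CTangent x) := by
      rw [Module.finrank_baseChange, hfr, Fintype.card_fin]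
    have : FiniteDimensional ℝ (TangentSpace (𝓡 4) x) := by
      change FiniteDimensional ℝ E4
      infer_instance
    let B := basisOfLinearIndependentOfCardEqFinrank hli hcard
    have hB : ∀ a, B a = T.e a x := fun a => by simp [B]
    have hv := B.sum_repr v
    simp only [hB] at hv
    generalize hc : (B.repr v : Fin 4 → ℂ) = c at hv
    rw [← hv]
    have hco : ∀ a, cmetric g x (T.e a x) (∑ b, c b • T.e b x) = ∑ b, c b * nu a b := fun a => by
      simp [map_sum, hT.products x hx]
    simp only [hco]
    simp [nu, Fin.sum_univ_four]
    module

namespace IsNullFrame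

variable {U : Set M} {h : CForm2 M} {T : TetradData M} (F : IsNullFrame U h T)

include F

theorem eventually_mem {x : M} (hx : x ∈ U) : ∀ᶠ y in 𝓝 x, y ∈ U := F.isOpen.mem_nhds hx

theorem ext_left {x : M} (hx : x ∈ U) {u v : CTangent x}
    (huv : ∀ a, h x (T.e a x) u = h x (T.e a x) v) : u = v := by
  rw [F.expand x hx u, F.expand x hx v]
  simp only [huv]

theorem ext_right {x : M} (hx : x ∈ U) {u v : CTangent x}
    (huv : ∀ a, h x u (T.e a x) = h x v (T.e a x)) : u = v :=
  F.ext_left hx fun a => by rw [F.symm, huv, F.symm]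

theorem exists_field {x : M} (hx : x ∈ U) (v : CTangent x) :
    ∃ X : CField M, VSmoothNear x X ∧ X x = v := by
  refine ⟨fun y => ∑ a, ∑ b, (nu a b * h x (T.e a x) v) • T.e b y, ?_, (F.expand x hx v).symm⟩
  exact .sum fun a _ => .sum fun b _ => .smul (.const x _) (F.frame_smooth x hx b)

theorem ddir_smooth {x : M} (hx : x ∈ U) {X : CField M} {φ : M → ℂ} (hX : VSmoothNear x X)
    (hφ : FSmoothNear x φ) : FSmoothNear x (ddir X φ) := by
  have h0 := F.frame_smooth x hx 0
  have h1 := F.frame_smooth x hx 1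
  have := (F.smooth x _ _ ((hX.cbracket (VSmoothNear.smul hφ h0)).sub
    (VSmoothNear.smul hφ (hX.cbracket h0))) h1)
  refine this.congr ?_
  filter_upwards [F.eventually_mem hx, hφ.eventually, h0.eventually] with y hy hφy h0y
  simp only [ev, Pi.sub_apply, cbracket_smul_right hφy h0y, add_sub_cancel_right, map_smul,
    LinearMap.smul_apply, F.products y hy]
  simp [nu]

theorem ddir_cbracket {x : M} (hx : x ∈ U) {X Y : CField M} {φ : M → ℂ} (hX : VSmoothNear x X)
    (hY : VSmoothNear x Y) (hφ : FSmoothNear x φ) :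
    ddir (cbracket X Y) φ x = ddir X (ddir Y φ) x - ddir Y (ddir X φ) x := by
  have h0 := F.frame_smooth x hx 0
  have aux : ∀ {A B : CField M}, VSmoothNear x A → VSmoothNear x B →
      cbracket A (cbracket B (fun y => φ y • T.e 0 y)) x
        = ddir A (ddir B φ) x • T.e 0 x + ddir B φ x • cbracket A (T.e 0) x
          + (ddir A φ x • cbracket B (T.e 0) x + φ x • cbracket A (cbracket B (T.e 0)) x) := by
    intro A B hA hB
    have : ∀ᶠ y in 𝓝 x, cbracket B (fun y => φ y • T.e 0 y) y
        = ((fun y => ddir B φ y • T.e 0 y) + (fun y => φ y • cbracket B (T.e 0) y)) y := by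
      filter_upwards [hφ.eventually, h0.eventually] with y hφy h0y
      rw [cbracket_smul_right hφy h0y]
      rfl
    have hd := F.ddir_smooth hx hB hφ
    rw [cbracket_congr (X := A) (Filter.Eventually.of_forall fun _ => rfl) this,
      cbracket_add_right (.smul hd h0) (.smul hφ (hB.cbracket h0)),
      cbracket_smul_right hd h0, cbracket_smul_right hφ (hB.cbracket h0)]
  have hJ := cbracket_jacobi hX hY (VSmoothNear.smul hφ h0)
  rw [aux hX hY, aux hY hX] at hJ
  have hsw := congrFun (cbracket_swap (fun y => φ y • T.e 0 y) (cbracket X Y)) x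
  rw [hsw, Pi.neg_apply, cbracket_smul_right hφ h0, neg_neg] at hJ
  have hJ0 := cbracket_jacobi hX hY h0
  rw [congrFun (cbracket_swap (T.e 0) (cbracket X Y)) x, Pi.neg_apply, neg_neg] at hJ0
  have key : (ddir (cbracket X Y) φ x - (ddir X (ddir Y φ) x - ddir Y (ddir X φ) x)) • T.e 0 x
      = 0 := by
    rw [hJ0] at hJ
    linear_combination (norm := module) -hJ
  have h01 := congrArg (fun v => h x v (T.e 1 x)) key
  simp only [map_smul, LinearMap.smul_apply, F.products x hx, map_zero, LinearMap.zero_apply] at h01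
  have : nu 0 1 = 1 := rfl
  simp only [this, smul_eq_mul, mul_one] at h01
  exact sub_eq_zero.1 h01

end IsNullFrame

end

section

variable {M : Type*} [TopologicalSpace M] [ChartedSpace E4 M]

theorem ev_smul_left (h : CForm2 M) (φ : M → ℂ) (X Y : CField M) :
    ev h (fun y => φ y • X y) Y = fun y => φ y * ev h X Y y := by ext1 y; simp [ev]

theorem ev_smul_right (h : CForm2 M) (φ : M → ℂ) (X Y : CField M) :
    ev h X (fun y => φ y • Y y) = fun y => φ y * ev h X Y y := by ext1 y; simp [ev]

theorem ev_add_left (h : CForm2 M) (X X₁ Y : CField M) :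
    ev h (X + X₁) Y = fun y => ev h X Y y + ev h X₁ Y y := by ext1 y; simp [ev]

theorem ev_add_right (h : CForm2 M) (X Y Y₁ : CField M) :
    ev h X (Y + Y₁) = fun y => ev h X Y y + ev h X Y₁ y := by ext1 y; simp [ev]

variable [IsManifold (𝓡 4) ∞ M]

namespace IsNullFrame

variable {U : Set M} {h : CForm2 M} {T : TetradData M} (F : IsNullFrame U h T)

/-! ### The Koszul form -/

include F

theorem ev_symm (X Y : CField M) : ev h X Y = ev h Y X := funext fun y => F.symm y _ _

theorem koszul_torsion (X Y Z : CField M) (x : M) :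
    koszul h X Y Z x - koszul h Y X Z x = 2 * h x (cbracket X Y x) (Z x) := by
  simp only [koszul, F.ev_symm Y X, cbracket_swap Y X, Pi.neg_apply, map_neg,
    LinearMap.neg_apply]
  ring

theorem koszul_metric (X Y Z : CField M) (x : M) :
    koszul h X Y Z x + koszul h X Z Y x = 2 * ddir X (ev h Y Z) x := by
  simp only [koszul, F.ev_symm Z Y, cbracket_swap Z Y, Pi.neg_apply, map_neg,
    LinearMap.neg_apply]
  ring

theorem koszul_add_left {x : M} {X X₁ Y Z : CField M} (hX : VSmoothNear x X)
    (hX₁ : VSmoothNear x X₁) (hY : VSmoothNear x Y) (hZ : VSmoothNear x Z) :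
    koszul h (X + X₁) Y Z x = koszul h X Y Z x + koszul h X₁ Y Z x := by
  simp only [koszul, ev_add_left, cbracket_add_left hX hX₁, map_add, LinearMap.add_apply, ddir,
    Pi.add_apply, dC_vec_add, dC_add (F.smooth x _ _ hX hZ) (F.smooth x _ _ hX₁ hZ),
    dC_add (F.smooth x _ _ hX hY) (F.smooth x _ _ hX₁ hY)]
  ring

theorem koszul_smul_left {x : M} {X Y Z : CField M} {φ : M → ℂ} (hφ : FSmoothNear x φ)
    (hX : VSmoothNear x X) (hY : VSmoothNear x Y) (hZ : VSmoothNear x Z) :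
    koszul h (fun y => φ y • X y) Y Z x = φ x * koszul h X Y Z x := by
  simp only [koszul, ev_smul_left, cbracket_smul_left hφ hX, map_sub, map_smul,
    LinearMap.sub_apply, LinearMap.smul_apply, ddir, dC_vec_smul, smul_eq_mul,
    dC_mul hφ (F.smooth x _ _ hX hZ), dC_mul hφ (F.smooth x _ _ hX hY)]
  simp only [ev]
  ring

theorem koszul_add_mid {x : M} {X Y Y₁ Z : CField M} (hX : VSmoothNear x X)
    (hY : VSmoothNear x Y) (hY₁ : VSmoothNear x Y₁) (hZ : VSmoothNear x Z) :
    koszul h X (Y + Y₁) Z x = koszul h X Y Z x + koszul h X Y₁ Z x := by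
  have e := F.koszul_add_left hY hY₁ hX hZ
  have t := F.koszul_torsion X (Y + Y₁) Z x
  rw [cbracket_add_right hY hY₁, map_add, LinearMap.add_apply] at t
  linear_combination t + e - F.koszul_torsion X Y Z x - F.koszul_torsion X Y₁ Z x

theorem koszul_smul_mid {x : M} {X Y Z : CField M} {φ : M → ℂ} (hφ : FSmoothNear x φ)
    (hX : VSmoothNear x X) (hY : VSmoothNear x Y) (hZ : VSmoothNear x Z) :
    koszul h X (fun y => φ y • Y y) Z x
      = 2 * ddir X φ x * h x (Y x) (Z x) + φ x * koszul h X Y Z x := by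
  have e := F.koszul_smul_left hφ hY hX hZ
  have t := F.koszul_torsion X (fun y => φ y • Y y) Z x
  rw [cbracket_smul_right hφ hY, map_add, LinearMap.add_apply, map_smul, map_smul,
    LinearMap.smul_apply, LinearMap.smul_apply, smul_eq_mul, smul_eq_mul] at t
  linear_combination t + e - φ x * F.koszul_torsion X Y Z x

theorem koszul_add_right {x : M} {X Y Z Z₁ : CField M} (hX : VSmoothNear x X)
    (hY : VSmoothNear x Y) (hZ : VSmoothNear x Z) (hZ₁ : VSmoothNear x Z₁) :
    koszul h X Y (Z + Z₁) x = koszul h X Y Z x + koszul h X Y Z₁ x := by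
  have e := F.koszul_add_mid hX hZ hZ₁ hY
  have t := F.koszul_metric X Y (Z + Z₁) x
  rw [ev_add_right] at t
  simp only [ddir, dC_add (F.smooth x _ _ hY hZ) (F.smooth x _ _ hY hZ₁)] at t
  have t1 := F.koszul_metric X Y Z x
  have t2 := F.koszul_metric X Y Z₁ x
  simp only [ddir] at t1 t2
  linear_combination t - e - t1 - t2

theorem koszul_smul_right {x : M} {X Y Z : CField M} {φ : M → ℂ} (hφ : FSmoothNear x φ)
    (hX : VSmoothNear x X) (hY : VSmoothNear x Y) (hZ : VSmoothNear x Z) :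
    koszul h X Y (fun y => φ y • Z y) x = φ x * koszul h X Y Z x := by
  have e := F.koszul_smul_mid hφ hX hZ hY
  have t := F.koszul_metric X Y (fun y => φ y • Z y) x
  rw [ev_smul_right] at t
  simp only [ddir, dC_mul hφ (F.smooth x _ _ hY hZ)] at t e
  have t1 := F.koszul_metric X Y Z x
  simp only [ddir] at t1
  have s := F.symm x (Y x) (Z x)
  simp only [ev] at t t1
  linear_combination t - e - φ x * t1 + 2 * dC φ x (X x) * s

theorem koszul_sum_right {ι : Type*} {s : Finset ι} {x : M} {X Y : CField M} {Z : ι → CField M}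
    (hX : VSmoothNear x X) (hY : VSmoothNear x Y) (hZ : ∀ i ∈ s, VSmoothNear x (Z i)) :
    koszul h X Y (fun y => ∑ i ∈ s, Z i y) x = ∑ i ∈ s, koszul h X Y (Z i) x := by
  classical
  induction s using Finset.induction_on with
  | empty =>
    have := F.koszul_smul_right (FSmoothNear.const x 0) hX hY hY
    simpa using this
  | insert i s hi ih =>
    simp only [Finset.sum_insert hi]
    rw [← ih fun j hj => hZ j (by simp [hj])]
    exact F.koszul_add_right hX hY (hZ i (by simp)) (.sum fun j hj => hZ j (by simp [hj]))

omit F [IsManifold (𝓡 4) ∞ M] in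
theorem koszul_congr {x : M} {X Y Z X₁ Y₁ Z₁ : CField M} (hX : ∀ᶠ y in 𝓝 x, X y = X₁ y)
    (hY : ∀ᶠ y in 𝓝 x, Y y = Y₁ y) (hZ : ∀ᶠ y in 𝓝 x, Z y = Z₁ y) :
    koszul h X Y Z x = koszul h X₁ Y₁ Z₁ x := by
  have aux : ∀ {A B A₁ B₁ : CField M}, (∀ᶠ y in 𝓝 x, A y = A₁ y) → (∀ᶠ y in 𝓝 x, B y = B₁ y) →
      ev h A B =ᶠ[𝓝 x] ev h A₁ B₁ := by
    intro A B A₁ B₁ hA hB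
    filter_upwards [hA, hB] with y hAy hBy
    simp only [ev, hAy, hBy]
  simp only [koszul, ddir, dC_congr (aux hY hZ), dC_congr (aux hX hZ), dC_congr (aux hX hY),
    cbracket_congr hX hY, cbracket_congr hX hZ, cbracket_congr hY hZ, hX.self_of_nhds,
    hY.self_of_nhds, hZ.self_of_nhds]

/-- Expansion of a smooth field in the frame. -/
theorem eventually_expand {x : M} (hx : x ∈ U) (Z : CField M) :
    ∀ᶠ y in 𝓝 x, Z y = ∑ a, ∑ b, (nu a b * ev h (T.e a) Z y) • T.e b y := by
  filter_upwards [F.eventually_mem hx] with y hy using F.expand y hy _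

/-! ### The Levi-Civita connection -/

/-- The Koszul formula determines the Levi-Civita derivative. -/
theorem leviCivita_spec {x : M} (hx : x ∈ U) {X Y : CField M} (hX : VSmoothNear x X)
    (hY : VSmoothNear x Y) {Z : CField M} (hZ : VSmoothNear x Z) :
    2 * h x (leviCivita h X Y x) (Z x) = koszul h X Y Z x := by
  refine Classical.epsilon_spec (p := fun v : CTangent x =>
    ∀ Z : CField M, VSmoothNear x Z → 2 * h x v (Z x) = koszul h X Y Z x) ?_ Z hZ
  refine ⟨∑ a, ∑ b, (nu a b * (koszul h X Y (T.e a) x / 2)) • T.e b x, fun Z hZ => ?_⟩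
  have he := F.frame_smooth x hx
  have hc : ∀ a b, FSmoothNear x (fun y => nu a b * ev h (T.e a) Z y) := fun a b =>
    .mul (.const x _) (F.smooth x _ _ (he a) hZ)
  rw [koszul_congr (Filter.Eventually.of_forall fun _ => rfl)
    (Filter.Eventually.of_forall fun _ => rfl) (F.eventually_expand hx Z),
    F.koszul_sum_right hX hY fun a _ => .sum fun b _ => .smul (hc a b) (he b)]
  have hk : ∀ a, koszul h X Y (fun y => ∑ b, (nu a b * ev h (T.e a) Z y) • T.e b y) x
      = ∑ b, nu a b * ev h (T.e a) Z x * koszul h X Y (T.e b) x := fun a => by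
    rw [F.koszul_sum_right hX hY fun b _ => .smul (hc a b) (he b)]
    exact Finset.sum_congr rfl fun b _ => F.koszul_smul_right (hc a b) hX hY (he b)
  rw [Finset.sum_congr rfl fun a _ => hk a]
  simp only [map_sum, map_smul, LinearMap.sum_apply,
    LinearMap.smul_apply, smul_eq_mul, Finset.mul_sum, ev]
  rw [Finset.sum_comm]
  refine Finset.sum_congr rfl fun b _ => Finset.sum_congr rfl fun a _ => ?_
  rw [nu_symm a b]
  ring

theorem leviCivita_eq {x : M} (hx : x ∈ U) {X Y : CField M} (hX : VSmoothNear x X)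
    (hY : VSmoothNear x Y) : leviCivita h X Y x
      = ∑ a, ∑ b, (nu a b * (koszul h X Y (T.e a) x * (1 / 2))) • T.e b x := by
  conv_lhs => rw [F.expand x hx (leviCivita h X Y x)]
  refine Finset.sum_congr rfl fun a _ => Finset.sum_congr rfl fun b _ => ?_
  rw [F.symm, ← F.leviCivita_spec hx hX hY (F.frame_smooth x hx a)]
  congr 2
  ring

theorem leviCivita_ext {x : M} (hx : x ∈ U) {X Y : CField M} (hX : VSmoothNear x X)
    (hY : VSmoothNear x Y) {v : CTangent x}
    (hv : ∀ Z, VSmoothNear x Z → 2 * h x v (Z x) = koszul h X Y Z x) :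
    leviCivita h X Y x = v := by
  refine F.ext_right hx fun a => ?_
  have h1 := F.leviCivita_spec hx hX hY (F.frame_smooth x hx a)
  have h2 := hv _ (F.frame_smooth x hx a)
  linear_combination (h1 - h2) / 2

theorem koszul_smooth {x : M} (hx : x ∈ U) {X Y Z : CField M} (hX : VSmoothNear x X)
    (hY : VSmoothNear x Y) (hZ : VSmoothNear x Z) : FSmoothNear x (koszul h X Y Z) :=
  (((((F.ddir_smooth hx hX (F.smooth x _ _ hY hZ)).add
    (F.ddir_smooth hx hY (F.smooth x _ _ hX hZ))).sub
    (F.ddir_smooth hx hZ (F.smooth x _ _ hX hY))).add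
    (F.smooth x _ _ (hX.cbracket hY) hZ)).sub
    (F.smooth x _ _ (hX.cbracket hZ) hY)).sub
    (F.smooth x _ _ (hY.cbracket hZ) hX)

theorem leviCivita_isWeylConnection : IsWeylConnection U h (fun _ => 0) (leviCivita h) where
  form_smooth x _ X _ := by simpa using FSmoothNear.const x 0
  smooth x hx X Y hX hY := by
    have he := F.frame_smooth x hx
    have : VSmoothNear x (fun y => ∑ a, ∑ b,
        (nu a b * (koszul h X Y (T.e a) y * (1 / 2))) • T.e b y) :=
      .sum fun a _ => .sum fun b _ => .smul (.mul (.const x _) (.mul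
        (F.koszul_smooth hx hX hY (he a)) (.const x _))) (he b)
    refine this.congr ?_
    filter_upwards [F.eventually_mem hx, hX.eventually, hY.eventually] with y hy hXy hYy
    exact (F.leviCivita_eq hy hXy hYy).symm
  add_left x hx X X₁ Y hX hX₁ hY := F.leviCivita_ext hx (hX.add hX₁) hY fun Z hZ => by
    rw [F.koszul_add_left hX hX₁ hY hZ, ← F.leviCivita_spec hx hX hY hZ,
      ← F.leviCivita_spec hx hX₁ hY hZ, map_add, LinearMap.add_apply, mul_add]
  smul_left x hx φ X Y hφ hX hY := F.leviCivita_ext hx (.smul hφ hX) hY fun Z hZ => by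
    rw [F.koszul_smul_left hφ hX hY hZ, ← F.leviCivita_spec hx hX hY hZ, map_smul,
      LinearMap.smul_apply, smul_eq_mul]
    ring
  add_right x hx X Y Y₁ hX hY hY₁ := F.leviCivita_ext hx hX (hY.add hY₁) fun Z hZ => by
    rw [F.koszul_add_mid hX hY hY₁ hZ, ← F.leviCivita_spec hx hX hY hZ,
      ← F.leviCivita_spec hx hX hY₁ hZ, map_add, LinearMap.add_apply, mul_add]
  leibniz x hx φ X Y hφ hX hY := F.leviCivita_ext hx hX (.smul hφ hY) fun Z hZ => by
    rw [F.koszul_smul_mid hφ hX hY hZ, ← F.leviCivita_spec hx hX hY hZ, map_add, map_smul,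
      map_smul, LinearMap.add_apply, LinearMap.smul_apply, LinearMap.smul_apply, smul_eq_mul,
      smul_eq_mul]
    ring
  torsion_free x hx X Y hX hY := F.ext_right hx fun a => by
    have hZ := F.frame_smooth x hx a
    have t := F.koszul_torsion X Y (T.e a) x
    rw [← F.leviCivita_spec hx hX hY hZ, ← F.leviCivita_spec hx hY hX hZ] at t
    rw [map_sub, LinearMap.sub_apply]
    linear_combination t / 2
  metric x hx X Y Z hX hY hZ := by
    have t := F.koszul_metric X Y Z x
    rw [← F.leviCivita_spec hx hX hY hZ, ← F.leviCivita_spec hx hX hZ hY] at t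
    rw [F.symm x (Y x), LinearMap.zero_apply]
    linear_combination - t / 2

end IsNullFrame

end

section

variable {M : Type*} [TopologicalSpace M] [ChartedSpace E4 M]

/-- The operator `(X, Y) ↦ D_X Y` is local. -/
def CConn.IsLocal (D : CConn M) : Prop :=
  ∀ (x : M) (X Y X₁ Y₁ : CField M), (∀ᶠ y in 𝓝 x, X y = X₁ y) → (∀ᶠ y in 𝓝 x, Y y = Y₁ y) →
    D X Y x = D X₁ Y₁ x

/-- The vector `f^♯` obtained by raising the index of a 1-form in the frame. -/
def sharp (T : TetradData M) (f : CForm1 M) (x : M) : CTangent x :=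
  ∑ a, ∑ b, (nu a b * f x (T.e a x)) • T.e b x

variable [IsManifold (𝓡 4) ∞ M]

theorem weylConn_apply (h : CForm2 M) (T : TetradData M) (f : CForm1 M) (X Y : CField M) (x : M) :
    weylConn h T f X Y x = leviCivita h X Y x + f x (X x) • Y x + f x (Y x) • X x
      - h x (X x) (Y x) • sharp T f x := rfl

theorem leviCivita_isLocal (h : CForm2 M) : CConn.IsLocal (leviCivita h) := by
  intro x X Y X₁ Y₁ hX hY
  have : ∀ Z, koszul h X Y Z x = koszul h X₁ Y₁ Z x := fun Z =>
    IsNullFrame.koszul_congr hX hY (Filter.Eventually.of_forall fun _ => rfl)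
  simp only [leviCivita, this]

theorem weylConn_isLocal (h : CForm2 M) (T : TetradData M) (f : CForm1 M) :
    CConn.IsLocal (weylConn h T f) := by
  intro x X Y X₁ Y₁ hX hY
  simp only [weylConn_apply, leviCivita_isLocal h x X Y X₁ Y₁ hX hY, hX.self_of_nhds,
    hY.self_of_nhds]

theorem covJ_weylConn (h : CForm2 M) (T : TetradData M) (f : CForm1 M) (J : CEnd M)
    (X Y : CField M) (x : M) : covJ (weylConn h T f) J X Y x = covJ (leviCivita h) J X Y x
      + f x (J x (Y x)) • X x - h x (X x) (J x (Y x)) • sharp T f x - f x (Y x) • J x (X x)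
      + h x (X x) (Y x) • J x (sharp T f x) := by
  simp only [covJ, weylConn_apply, map_add, map_sub, map_smul, app]
  module

/-! ### Formal properties of Weyl connections -/

namespace IsWeylConnection

variable {U : Set M} {h : CForm2 M} {f : CForm1 M} {D : CConn M} (W : IsWeylConnection U h f D)

include W

theorem sum_left {ι : Type*} {s : Finset ι} {x : M} (hx : x ∈ U) {Y : CField M}
    {X : ι → CField M} (hY : VSmoothNear x Y) (hX : ∀ i ∈ s, VSmoothNear x (X i)) :
    D (fun y => ∑ i ∈ s, X i y) Y x = ∑ i ∈ s, D (X i) Y x := by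
  classical
  induction s using Finset.induction_on with
  | empty =>
    have := W.smul_left x hx (fun _ => 0) Y Y (.const x 0) hY hY
    simpa using this
  | insert i s hi ih =>
    simp only [Finset.sum_insert hi]
    rw [← ih fun j hj => hX j (by simp [hj])]
    exact W.add_left x hx _ _ _ (hX i (by simp)) (.sum fun j hj => hX j (by simp [hj])) hY

theorem sum_right {ι : Type*} {s : Finset ι} {x : M} (hx : x ∈ U) {X : CField M}
    {Y : ι → CField M} (hX : VSmoothNear x X) (hY : ∀ i ∈ s, VSmoothNear x (Y i)) :
    D X (fun y => ∑ i ∈ s, Y i y) x = ∑ i ∈ s, D X (Y i) x := by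
  classical
  induction s using Finset.induction_on with
  | empty =>
    have := W.leibniz x hx (fun _ => 0) X X (.const x 0) hX hX
    simpa [ddir, dC_const] using this
  | insert i s hi ih =>
    simp only [Finset.sum_insert hi]
    rw [← ih fun j hj => hY j (by simp [hj])]
    exact W.add_right x hx _ _ _ hX (hY i (by simp)) (.sum fun j hj => hY j (by simp [hj]))

theorem covJ_sum_right {J : CEnd M} {ι : Type*} {s : Finset ι} {x : M} (hx : x ∈ U)
    {X : CField M} {φ : ι → M → ℂ} {Y : ι → CField M} (hX : VSmoothNear x X)
    (hφ : ∀ i ∈ s, FSmoothNear x (φ i)) (hY : ∀ i ∈ s, VSmoothNear x (Y i))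
    (hJY : ∀ i ∈ s, VSmoothNear x (app J (Y i))) :
    covJ D J X (fun y => ∑ i ∈ s, φ i y • Y i y) x = ∑ i ∈ s, φ i x • covJ D J X (Y i) x := by
  have : app J (fun y => ∑ i ∈ s, φ i y • Y i y) = fun y => ∑ i ∈ s, φ i y • app J (Y i) y := by
    ext1 y; simp [app]
  simp only [covJ]
  rw [this, W.sum_right hx hX fun i hi => .smul (hφ i hi) (hJY i hi),
    W.sum_right hx hX fun i hi => .smul (hφ i hi) (hY i hi), map_sum, ← Finset.sum_sub_distrib]
  refine Finset.sum_congr rfl fun i hi => ?_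
  rw [W.leibniz x hx _ _ _ (hφ i hi) hX (hJY i hi), W.leibniz x hx _ _ _ (hφ i hi) hX (hY i hi),
    map_add, map_smul, map_smul, app]
  module

theorem covJ_sum_left {J : CEnd M} {ι : Type*} {s : Finset ι} {x : M} (hx : x ∈ U)
    {Y : CField M} {φ : ι → M → ℂ} {X : ι → CField M} (hY : VSmoothNear x Y)
    (hJY : VSmoothNear x (app J Y)) (hφ : ∀ i ∈ s, FSmoothNear x (φ i))
    (hX : ∀ i ∈ s, VSmoothNear x (X i)) :
    covJ D J (fun y => ∑ i ∈ s, φ i y • X i y) Y x = ∑ i ∈ s, φ i x • covJ D J (X i) Y x := by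
  simp only [covJ]
  rw [W.sum_left hx hY fun i hi => .smul (hφ i hi) (hX i hi),
    W.sum_left hx hJY fun i hi => .smul (hφ i hi) (hX i hi), map_sum, ← Finset.sum_sub_distrib]
  refine Finset.sum_congr rfl fun i hi => ?_
  rw [W.smul_left x hx _ _ _ (hφ i hi) (hX i hi) hJY, W.smul_left x hx _ _ _ (hφ i hi) (hX i hi) hY,
    map_smul]
  module

theorem koszul (hs : ∀ x u v, h x u v = h x v u) {x : M} (hx : x ∈ U) {X Y Z : CField M}
    (hX : VSmoothNear x X) (hY : VSmoothNear x Y) (hZ : VSmoothNear x Z) :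
    2 * h x (D X Y x) (Z x) = Spacetime.koszul h X Y Z x + 2 * f x (X x) * h x (Y x) (Z x)
      + 2 * f x (Y x) * h x (X x) (Z x) - 2 * f x (Z x) * h x (X x) (Y x) := by
  have m1 := W.metric x hx X Y Z hX hY hZ
  have m2 := W.metric x hx Y X Z hY hX hZ
  have m3 := W.metric x hx Z X Y hZ hX hY
  simp only [Spacetime.koszul, ← W.torsion_free x hx X Y hX hY, ← W.torsion_free x hx X Z hX hZ,
    ← W.torsion_free x hx Y Z hY hZ, map_sub, LinearMap.sub_apply]
  rw [hs x (Y x) (D X Z x)] at m1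
  rw [hs x (X x) (D Y Z x)] at m2
  rw [hs x (X x) (D Z Y x)] at m3
  linear_combination -m1 - m2 + m3

/-- A torsion-free connection preserving `J` forces `J` to be integrable. -/
theorem isIntegrable {J : CEnd M} (hJ2 : ∀ x ∈ U, ∀ u, J x (J x u) = -u)
    (hJs : ∀ x ∈ U, ∀ X, VSmoothNear x X → VSmoothNear x (app J X)) (hP : IsParallel U D J) :
    IsIntegrable U J := by
  intro x hx X Y hX hY
  have hJX := hJs x hx X hX
  have hJY := hJs x hx Y hY
  have p := fun A B hA hB => sub_eq_zero.1 (hP x hx A B hA hB)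
  simp only [nijenhuis, ← W.torsion_free x hx _ _ hX hY, ← W.torsion_free x hx _ _ hJX hY,
    ← W.torsion_free x hx _ _ hX hJY, ← W.torsion_free x hx _ _ hJX hJY, map_sub,
    p X Y hX hY, p Y X hY hX, p _ Y hJX hY, p _ X hJY hX, hJ2 x hx]
  abel

/-- The Kähler form of a parallel skew `J` is closed for a Levi-Civita connection. -/
theorem isClosedForm2 {J : CEnd M} (hf : ∀ x ∈ U, f x = 0) (hs : ∀ x u v, h x u v = h x v u)
    (hskew : ∀ x u v, h x (J x u) v = - h x u (J x v))
    (hJs : ∀ x ∈ U, ∀ X, VSmoothNear x X → VSmoothNear x (app J X)) (hP : IsParallel U D J) :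
    IsClosedForm2 U (kahlerForm h J) := by
  refine ⟨fun x _ u => ?_, fun x hx X Y Z hX hY hZ => ?_⟩
  · change h x (J x u) u = 0
    have := hskew x u u
    rw [hs x u (J x u)] at this
    exact self_eq_neg.1 this
  · have p := fun A B hA hB => sub_eq_zero.1 (hP x hx A B hA hB)
    have key : ∀ {A B C : CField M}, VSmoothNear x A → VSmoothNear x B → VSmoothNear x C →
        ddir A (ev (kahlerForm h J) B C) x
          = h x (J x (D A B x)) (C x) + h x (J x (B x)) (D A C x) := by
      intro A B C hA hB hC
      have m := W.metric x hx A (app J B) C hA (hJs x hx B hB) hC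
      rw [hf x hx, LinearMap.zero_apply, p A B hA hB] at m
      have : ev (kahlerForm h J) B C = ev h (app J B) C := rfl
      rw [this]
      simp only [app] at m
      linear_combination m
    have kf : ∀ u v, kahlerForm h J x u v = h x (J x u) v := fun _ _ => rfl
    have sk : ∀ u v, h x (J x u) v = - h x (J x v) u := fun u v => by
      rw [hskew, hs]
    simp only [key hX hY hZ, key hY hZ hX, key hZ hX hY, kf, ← W.torsion_free x hx X Y hX hY,
      ← W.torsion_free x hx Y Z hY hZ, ← W.torsion_free x hx Z X hZ hX, map_sub,
      LinearMap.sub_apply]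
    rw [sk (Y x) (D X Z x), sk (Z x) (D Y X x), sk (X x) (D Z Y x)]
    ring

/-- A Weyl connection with exact 1-form is the Levi-Civita connection of a rescaled metric. -/
theorem isLeviCivita_rescale {V : Set M} {Φ : M → ℂ} (hVU : V ⊆ U)
    (hΦ : ∀ x ∈ V, FSmoothNear x Φ)
    (hh : ∀ x X Y, VSmoothNear x X → VSmoothNear x Y → FSmoothNear x (ev h X Y))
    (hfΦ : ∀ x ∈ V, ∀ v, dC Φ x v = 2 * f x v * Φ x) :
    IsLeviCivita V (rescale Φ h) D where
  form_smooth x _ X _ := by simpa using FSmoothNear.const x 0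
  smooth x hx := W.smooth x (hVU hx)
  add_left x hx := W.add_left x (hVU hx)
  smul_left x hx := W.smul_left x (hVU hx)
  add_right x hx := W.add_right x (hVU hx)
  leibniz x hx := W.leibniz x (hVU hx)
  torsion_free x hx := W.torsion_free x (hVU hx)
  metric x hx X Y Z hX hY hZ := by
    have m := W.metric x (hVU hx) X Y Z hX hY hZ
    have : ev (rescale Φ h) Y Z = fun y => Φ y * ev h Y Z y := rfl
    have r : ∀ u v, rescale Φ h x u v = Φ x * h x u v := fun _ _ => rfl
    simp only [ddir] at m
    simp only [this, ddir, r, dC_mul (hΦ x hx) (hh x Y Z hY hZ), hfΦ x hx, LinearMap.zero_apply]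
    simp only [ev] at *
    linear_combination Φ x * m

end IsWeylConnection

namespace IsNullFrame

variable {U : Set M} {h : CForm2 M} {T : TetradData M} (F : IsNullFrame U h T)

include F

theorem sharp_spec {x : M} (hx : x ∈ U) (f : CForm1 M) (v : CTangent x) :
    h x (sharp T f x) v = f x v := by
  conv_rhs => rw [F.expand x hx v]
  simp only [sharp, map_sum, map_smul, LinearMap.sum_apply, LinearMap.smul_apply, smul_eq_mul]
  rw [Finset.sum_comm]
  refine Finset.sum_congr rfl fun b _ => Finset.sum_congr rfl fun a _ => ?_
  rw [nu_symm a b]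
  ring

theorem sharp_smooth {x : M} (hx : x ∈ U) {f : CForm1 M}
    (hf : ∀ x ∈ U, ∀ X, VSmoothNear x X → FSmoothNear x (fun y => f y (X y))) :
    VSmoothNear x (sharp T f) :=
  .sum fun a _ => .sum fun b _ => .smul (.mul (.const x _) (hf x hx _ (F.frame_smooth x hx a)))
    (F.frame_smooth x hx b)

theorem weylConn_isWeylConnection {f : CForm1 M}
    (hf : ∀ x ∈ U, ∀ X, VSmoothNear x X → FSmoothNear x (fun y => f y (X y))) :
    IsWeylConnection U h f (weylConn h T f) := by
  have L := F.leviCivita_isWeylConnection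
  refine ⟨hf, ?_, ?_, ?_, ?_, ?_, ?_, ?_⟩
  · intro x hx X Y hX hY
    exact (((L.smooth x hx X Y hX hY).add (.smul (hf x hx X hX) hY)).add
      (.smul (hf x hx Y hY) hX)).sub (.smul (F.smooth x X Y hX hY) (F.sharp_smooth hx hf))
  · intro x hx X X₁ Y hX hX₁ hY
    simp only [weylConn_apply, L.add_left x hx X X₁ Y hX hX₁ hY, Pi.add_apply, map_add,
      LinearMap.add_apply]
    module
  · intro x hx φ X Y hφ hX hY
    simp only [weylConn_apply, L.smul_left x hx φ X Y hφ hX hY, map_smul, LinearMap.smul_apply,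
      smul_eq_mul]
    module
  · intro x hx X Y Y₁ hX hY hY₁
    simp only [weylConn_apply, L.add_right x hx X Y Y₁ hX hY hY₁, Pi.add_apply, map_add]
    module
  · intro x hx φ X Y hφ hX hY
    simp only [weylConn_apply, L.leibniz x hx φ X Y hφ hX hY, map_smul, smul_eq_mul]
    module
  · intro x hx X Y hX hY
    rw [← L.torsion_free x hx X Y hX hY]
    simp only [weylConn_apply, F.symm x (Y x) (X x)]
    module
  · intro x hx X Y Z hX hY hZ
    have m := L.metric x hx X Y Z hX hY hZ
    simp only [LinearMap.zero_apply] at m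
    simp only [weylConn_apply, map_add, map_sub, map_smul, LinearMap.add_apply,
      LinearMap.sub_apply, LinearMap.smul_apply, smul_eq_mul, F.sharp_spec hx,
      F.symm x (Y x) (sharp T f x)]
    rw [F.symm x (Y x) (X x)]
    linear_combination m

theorem eq_weylConn {f : CForm1 M} {D : CConn M} (W : IsWeylConnection U h f D) {x : M}
    (hx : x ∈ U) {X Y : CField M} (hX : VSmoothNear x X) (hY : VSmoothNear x Y) :
    D X Y x = weylConn h T f X Y x := by
  refine F.ext_right hx fun a => ?_
  have hZ := F.frame_smooth x hx a
  have h1 := W.koszul F.symm hx hX hY hZ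
  have h2 := (F.weylConn_isWeylConnection W.form_smooth).koszul F.symm hx hX hY hZ
  linear_combination (h1 - h2) / 2

end IsNullFrame

end

section

variable {M : Type*} [TopologicalSpace M] [ChartedSpace E4 M]

/-- The eigenvalues of `J` on the null frame, divided by `i`. -/
def sJ : Fin 4 → ℂ := ![-1, 1, -1, 1]

theorem tetradJ_apply (h : CForm2 M) (T : TetradData M) (x : M) (v : CTangent x) :
    tetradJ h T x v = Complex.I • (h x (T.e 0 x) v • T.e 1 x - h x (T.e 1 x) v • T.e 0 x
      + h x (T.e 3 x) v • T.e 2 x - h x (T.e 2 x) v • T.e 3 x) := rfl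

/-- The components of a vector in the null frame. -/
def cf (h : CForm2 M) (T : TetradData M) (b : Fin 4) (x : M) : CTangent x →ₗ[ℂ] ℂ :=
  ∑ a, nu a b • h x (T.e a x)

theorem cf_apply (h : CForm2 M) (T : TetradData M) (b : Fin 4) (x : M) (v : CTangent x) :
    cf h T b x v = ∑ a, nu a b * h x (T.e a x) v := by simp [cf]

variable [IsManifold (𝓡 4) ∞ M]

/-- The connection coefficients `γ_{abc} = h(∇_{e_a} e_b, e_c)` of the Levi-Civita connection. -/
def gam (h : CForm2 M) (T : TetradData M) (a b c : Fin 4) : M → ℂ :=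
  ev h (leviCivita h (T.e a) (T.e b)) (T.e c)

namespace IsNullFrame

variable {U : Set M} {h : CForm2 M} {T : TetradData M} (F : IsNullFrame U h T)

include F

theorem expand_cf {x : M} (hx : x ∈ U) (v : CTangent x) : v = ∑ b, cf h T b x v • T.e b x := by
  conv_lhs => rw [F.expand x hx v, Finset.sum_comm]
  simp only [cf_apply, Finset.sum_smul]

theorem cf_smooth {x : M} (hx : x ∈ U) (b : Fin 4) {X : CField M} (hX : VSmoothNear x X) :
    FSmoothNear x (fun y => cf h T b y (X y)) := by
  simp only [cf_apply]
  exact .sum fun a _ => .mul (.const x _) (F.smooth x _ _ (F.frame_smooth x hx a) hX)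

theorem linear_ext {x : M} (hx : x ∈ U) {V : Type*} [AddCommGroup V] [Module ℂ V]
    {A B : CTangent x →ₗ[ℂ] V} (hAB : ∀ a, A (T.e a x) = B (T.e a x)) : A = B := by
  refine LinearMap.ext fun v => ?_
  rw [F.expand_cf hx v]
  simp only [map_sum, map_smul, hAB]

/-! ### The almost-complex structure -/

theorem tetradJ_frame {x : M} (hx : x ∈ U) (a : Fin 4) :
    tetradJ h T x (T.e a x) = (Complex.I * sJ a) • T.e a x := by
  rw [tetradJ_apply]
  simp only [F.products x hx]
  fin_cases a <;> simp [nu, sJ]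

theorem tetradJ_skew (x : M) (u v : CTangent x) :
    h x (tetradJ h T x u) v = - h x u (tetradJ h T x v) := by
  simp only [tetradJ_apply, map_smul, map_add, map_sub, LinearMap.smul_apply, LinearMap.add_apply,
    LinearMap.sub_apply, smul_eq_mul, F.symm x u]
  ring

theorem tetradJ_sq {x : M} (hx : x ∈ U) (u : CTangent x) :
    tetradJ h T x (tetradJ h T x u) = -u := by
  have : tetradJ h T x ∘ₗ tetradJ h T x = -LinearMap.id := by
    refine F.linear_ext hx fun a => ?_
    simp only [LinearMap.comp_apply, F.tetradJ_frame hx, map_smul, smul_smul, LinearMap.neg_apply,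
      LinearMap.id_apply]
    have : Complex.I * sJ a * (Complex.I * sJ a) = -1 := by
      have hs : sJ a * sJ a = 1 := by fin_cases a <;> simp [sJ]
      linear_combination sJ a * sJ a * Complex.I_mul_I - hs
    rw [this, neg_one_smul]
  exact LinearMap.congr_fun this u

theorem tetradJ_compatible {x : M} (hx : x ∈ U) (u v : CTangent x) :
    h x (tetradJ h T x u) (tetradJ h T x v) = h x u v := by
  rw [F.tetradJ_skew, F.tetradJ_sq hx, map_neg, neg_neg]

theorem tetradJ_smooth {x : M} (hx : x ∈ U) {X : CField M} (hX : VSmoothNear x X) :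
    VSmoothNear x (app (tetradJ h T) X) := by
  have he := F.frame_smooth x hx
  have t := fun a b => VSmoothNear.smul (F.smooth x _ _ (he a) hX) (he b)
  have := VSmoothNear.smul (.const x Complex.I) ((((t 0 1).sub (t 1 0)).add (t 3 2)).sub (t 2 3))
  refine this.congr (Filter.Eventually.of_forall fun y => ?_)
  rw [app, tetradJ_apply]
  simp only [Pi.sub_apply, Pi.add_apply, ev]

theorem eventually_app_frame {x : M} (hx : x ∈ U) (a : Fin 4) :
    ∀ᶠ y in 𝓝 x, app (tetradJ h T) (T.e a) y = (Complex.I * sJ a) • T.e a y := by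
  filter_upwards [F.eventually_mem hx] with y hy using F.tetradJ_frame hy a

/-! ### Connection coefficients -/

theorem leviCivita_frame_smooth {x : M} (hx : x ∈ U) (a b : Fin 4) :
    VSmoothNear x (leviCivita h (T.e a) (T.e b)) :=
  F.leviCivita_isWeylConnection.smooth x hx _ _ (F.frame_smooth x hx a) (F.frame_smooth x hx b)

theorem gam_smooth {x : M} (hx : x ∈ U) (a b c : Fin 4) : FSmoothNear x (gam h T a b c) :=
  F.smooth x _ _ (F.leviCivita_frame_smooth hx a b) (F.frame_smooth x hx c)

theorem gam_skew {x : M} (hx : x ∈ U) (a b c : Fin 4) : gam h T a b c x = - gam h T a c b x := by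
  have he := F.frame_smooth x hx
  have m := F.leviCivita_isWeylConnection.metric x hx _ _ _ (he a) (he b) (he c)
  have : ev h (T.e b) (T.e c) =ᶠ[𝓝 x] fun _ => nu b c := by
    filter_upwards [F.eventually_mem hx] with y hy using F.products y hy b c
  rw [ddir, dC_congr this, dC_const, LinearMap.zero_apply, F.symm x (T.e b x)] at m
  simp only [gam, ev]
  linear_combination -m

theorem gam_self {x : M} (hx : x ∈ U) (a b : Fin 4) : gam h T a b b x = 0 :=
  self_eq_neg.1 (F.gam_skew hx a b b)

theorem covJ_tensorial {f : CForm1 M} {D : CConn M} (W : IsWeylConnection U h f D)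
    (hD : D.IsLocal) {x : M} (hx : x ∈ U) {X Y : CField M} (hX : VSmoothNear x X)
    (hY : VSmoothNear x Y) : covJ D (tetradJ h T) X Y x
      = ∑ a, ∑ b, (cf h T a x (X x) * cf h T b x (Y x)) •
        covJ D (tetradJ h T) (T.e a) (T.e b) x := by
  have he := F.frame_smooth x hx
  have hJe := fun a => F.tetradJ_smooth hx (he a)
  have cX := fun a => F.cf_smooth hx a hX
  have cY := fun a => F.cf_smooth hx a hY
  have eX : ∀ᶠ y in 𝓝 x, X y = ∑ a, cf h T a y (X y) • T.e a y := by
    filter_upwards [F.eventually_mem hx] with y hy using F.expand_cf hy _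
  have eY : ∀ᶠ y in 𝓝 x, Y y = ∑ a, cf h T a y (Y y) • T.e a y := by
    filter_upwards [F.eventually_mem hx] with y hy using F.expand_cf hy _
  have eJY : ∀ᶠ y in 𝓝 x, app (tetradJ h T) Y y
      = app (tetradJ h T) (fun y => ∑ a, cf h T a y (Y y) • T.e a y) y := by
    filter_upwards [eY] with y hy using congrArg (tetradJ h T y) hy
  have h1 : covJ D (tetradJ h T) X Y x = covJ D (tetradJ h T)
      (fun y => ∑ a, cf h T a y (X y) • T.e a y) (fun y => ∑ a, cf h T a y (Y y) • T.e a y) x := by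
    simp only [covJ]
    rw [hD x _ _ _ _ eX eY, hD x _ _ _ _ eX eJY]
  have sY : VSmoothNear x (fun y => ∑ a, cf h T a y (Y y) • T.e a y) :=
    .sum fun a _ => .smul (cY a) (he a)
  rw [h1, W.covJ_sum_left hx sY (F.tetradJ_smooth hx sY) (fun a _ => cX a) fun a _ => he a]
  refine Finset.sum_congr rfl fun a _ => ?_
  rw [W.covJ_sum_right hx (he a) (fun b _ => cY b) (fun b _ => he b) fun b _ => hJe b,
    Finset.smul_sum]
  simp only [smul_smul]

theorem covJ_frame {x : M} (hx : x ∈ U) (a b c : Fin 4) :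
    h x (covJ (leviCivita h) (tetradJ h T) (T.e a) (T.e b) x) (T.e c x)
      = Complex.I * (sJ b + sJ c) * gam h T a b c x := by
  have he := F.frame_smooth x hx
  have L := F.leviCivita_isWeylConnection
  have h1 : leviCivita h (T.e a) (app (tetradJ h T) (T.e b)) x
      = (Complex.I * sJ b) • leviCivita h (T.e a) (T.e b) x := by
    rw [leviCivita_isLocal h x _ _ _ _ (Filter.Eventually.of_forall fun _ => rfl)
      (F.eventually_app_frame hx b), L.leibniz x hx _ _ _ (.const x _) (he a) (he b)]
    simp [ddir, dC_const]
  simp only [covJ, h1, map_sub, map_smul, LinearMap.sub_apply, LinearMap.smul_apply,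
    F.tetradJ_skew, F.tetradJ_frame hx, smul_eq_mul, gam, ev]
  ring

theorem preferredComp_frame {x : M} (hx : x ∈ U) (b : Fin 4) :
    preferredComp h T (tetradJ h T) (T.e b) x
      = 1 / 2 * ∑ a, ∑ c, nu a c * (sJ a * (sJ b + sJ c) * gam h T a b c x) := by
  have he := F.frame_smooth x hx
  have L := F.leviCivita_isWeylConnection
  have h1 : ∀ a, covJ (leviCivita h) (tetradJ h T) (app (tetradJ h T) (T.e a)) (T.e b) x
      = (Complex.I * sJ a) • covJ (leviCivita h) (tetradJ h T) (T.e a) (T.e b) x := fun a => by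
    have h2 : ∀ Y, VSmoothNear x Y → leviCivita h (app (tetradJ h T) (T.e a)) Y x
        = (Complex.I * sJ a) • leviCivita h (T.e a) Y x := fun Y hY => by
      rw [leviCivita_isLocal h x _ _ _ _ (F.eventually_app_frame hx a)
        (Filter.Eventually.of_forall fun _ => rfl), L.smul_left x hx _ _ _ (.const x _) (he a) hY]
    simp only [covJ]
    rw [h2 _ (F.tetradJ_smooth hx (he b)), h2 _ (he b), map_smul, smul_sub]
  simp only [preferredComp, ev, h1, map_smul, LinearMap.smul_apply, F.covJ_frame hx, smul_eq_mul,
    Finset.mul_sum]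
  refine Finset.sum_congr rfl fun a _ => Finset.sum_congr rfl fun c _ => ?_
  linear_combination (-1 / 2 * nu a c * sJ a * (sJ b + sJ c) * gam h T a b c x) * Complex.I_mul_I

omit F in
theorem preferredForm_eq {x : M} (v : CTangent x) : preferredForm h T x v
    = ∑ b, cf h T b x v * preferredComp h T (tetradJ h T) (T.e b) x := by
  simp only [preferredForm, LinearMap.sum_apply, LinearMap.smul_apply, smul_eq_mul, cf_apply,
    Finset.sum_mul]
  refine Finset.sum_congr rfl fun a _ => Finset.sum_congr rfl fun b _ => ?_
  rw [nu_symm a b]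
  ring

theorem cf_frame {x : M} (hx : x ∈ U) (a b : Fin 4) :
    cf h T b x (T.e a x) = if b = a then 1 else 0 := by
  simp only [cf_apply, F.products x hx]
  fin_cases a <;> fin_cases b <;> simp [Fin.sum_univ_four, nu]

theorem preferredForm_frame {x : M} (hx : x ∈ U) (a : Fin 4) : preferredForm h T x (T.e a x)
    = (![gam h T 3 0 2, gam h T 2 1 3, gam h T 1 0 2, gam h T 0 1 3] a) x := by
  rw [preferredForm_eq]
  simp only [F.cf_frame hx, F.preferredComp_frame hx]
  have s := F.gam_self hx
  have k := F.gam_skew hx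
  fin_cases a <;> simp [Fin.sum_univ_four, nu, sJ, s]
  · ring
  · ring
  · rw [k 1 2 0]; ring
  · rw [k 0 3 1]; ring

theorem preferredForm_smooth {x : M} (hx : x ∈ U) {X : CField M} (hX : VSmoothNear x X) :
    FSmoothNear x (fun y => preferredForm h T y (X y)) := by
  have : FSmoothNear x (fun y => ∑ b, cf h T b y (X y)
      * (1 / 2 * ∑ a, ∑ c, nu a c * (sJ a * (sJ b + sJ c) * gam h T a b c y))) :=
    .sum fun b _ => .mul (F.cf_smooth hx b hX) (.mul (.const x _) (.sum fun a _ => .sum fun c _ =>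
      .mul (.const x _) (.mul (.const x _) (F.gam_smooth hx a b c))))
  refine this.congr ?_
  filter_upwards [F.eventually_mem hx] with y hy
  rw [preferredForm_eq]
  simp only [F.preferredComp_frame hy]

/-- The divergence of `J` for the Levi-Civita connection is `-2 f(J ·)`. -/
theorem divJ_leviCivita {x : M} (hx : x ∈ U) {X : CField M} (hX : VSmoothNear x X) :
    divJ h T (leviCivita h) (tetradJ h T) X x
      = -2 * preferredForm h T x (tetradJ h T x (X x)) := by
  have he := F.frame_smooth x hx
  have h1 : ∀ a c, h x (covJ (leviCivita h) (tetradJ h T) (T.e a) X x) (T.e c x)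
      = ∑ b, cf h T b x (X x) * (Complex.I * (sJ b + sJ c) * gam h T a b c x) := fun a c => by
    rw [F.covJ_tensorial F.leviCivita_isWeylConnection (leviCivita_isLocal h) hx (he a) hX]
    simp [F.cf_frame hx, F.covJ_frame hx]
  have h2 : preferredForm h T x (tetradJ h T x (X x))
      = ∑ b, cf h T b x (X x) * (Complex.I * sJ b * preferredForm h T x (T.e b x)) := by
    conv_lhs => rw [F.expand_cf hx (X x)]
    simp only [map_sum, map_smul, F.tetradJ_frame hx, smul_eq_mul]
  have s := F.gam_self hx
  have k := F.gam_skew hx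
  simp only [divJ, ev, h1, h2, F.preferredForm_frame hx]
  simp [Fin.sum_univ_four, nu, sJ, s]
  rw [k 1 2 0, k 0 3 1]
  ring

theorem divJ_weylConn {x : M} (hx : x ∈ U) {f : CForm1 M} {X : CField M}
    (hX : VSmoothNear x X) : divJ h T (weylConn h T f) (tetradJ h T) X x
      = 2 * (f x (tetradJ h T x (X x)) - preferredForm h T x (tetradJ h T x (X x))) := by
  have d := F.divJ_leviCivita hx hX
  simp only [divJ, ev] at d ⊢
  have e1 : f x (tetradJ h T x (X x)) = ∑ a, ∑ b, nu a b *
      (h x (T.e a x) (tetradJ h T x (X x)) * f x (T.e b x)) := by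
    conv_lhs => rw [F.expand x hx (tetradJ h T x (X x))]
    simp only [map_sum, map_smul, smul_eq_mul, mul_assoc]
  have e2 : f x (tetradJ h T x (X x)) = - ∑ a, ∑ b, nu a b *
      (h x (T.e a x) (X x) * h x (tetradJ h T x (sharp T f x)) (T.e b x)) := by
    rw [← F.sharp_spec hx f, ← neg_eq_iff_eq_neg, ← F.tetradJ_skew]
    conv_lhs => rw [F.expand x hx (X x)]
    simp only [map_sum, map_smul, smul_eq_mul, mul_assoc]
  have e3 : ∑ a, ∑ b, nu a b * (f x (tetradJ h T x (X x)) * nu a b)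
      = 4 * f x (tetradJ h T x (X x)) := by
    simp [Fin.sum_univ_four, nu]; ring
  have e4 : ∑ a, ∑ b, nu a b * (f x (X x) * h x (tetradJ h T x (T.e a x)) (T.e b x)) = 0 := by
    simp only [F.tetradJ_frame hx, map_smul, LinearMap.smul_apply, F.products x hx, smul_eq_mul]
    simp [Fin.sum_univ_four, nu, sJ]
  simp only [covJ_weylConn, map_add, map_sub, map_smul, LinearMap.add_apply, LinearMap.sub_apply,
    LinearMap.smul_apply, smul_eq_mul, F.products x hx, F.sharp_spec hx, mul_add, mul_sub,
    Finset.sum_add_distrib, Finset.sum_sub_distrib, d, e3, e4]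
  linear_combination e1 + e2

/-! ### Uniqueness, parallelism -/

theorem preferred_unique {f₁ : CForm1 M} {D₁ : CConn M} (W : IsWeylConnection U h f₁ D₁)
    (hd : ∀ x ∈ U, ∀ X, VSmoothNear x X → divJ h T D₁ (tetradJ h T) X x = 0) {x : M}
    (hx : x ∈ U) : f₁ x = preferredForm h T x := by
  refine F.linear_ext hx fun a => ?_
  obtain ⟨X, hX, hXx⟩ := F.exists_field hx (- tetradJ h T x (T.e a x))
  have e : divJ h T D₁ (tetradJ h T) X x = divJ h T (weylConn h T f₁) (tetradJ h T) X x := by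
    have he := F.frame_smooth x hx
    simp only [divJ, ev, covJ, F.eq_weylConn W hx (he _) hX,
      F.eq_weylConn W hx (he _) (F.tetradJ_smooth hx hX)]
  rw [hd x hx X hX, F.divJ_weylConn hx hX, hXx, map_neg, F.tetradJ_sq hx, neg_neg] at e
  linear_combination -e / 2

theorem isParallel_of_frame {f : CForm1 M} {D : CConn M} (W : IsWeylConnection U h f D)
    (hD : D.IsLocal)
    (hp : ∀ x ∈ U, ∀ a b, covJ D (tetradJ h T) (T.e a) (T.e b) x = 0) :
    IsParallel U D (tetradJ h T) := by
  intro x hx X Y hX hY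
  rw [F.covJ_tensorial W hD hx hX hY]
  simp [hp x hx]

theorem preferredConn_isWeylConnection :
    IsWeylConnection U h (preferredForm h T) (preferredConn h T) :=
  F.weylConn_isWeylConnection fun _ hx _ hX => F.preferredForm_smooth hx hX

theorem isParallel_preferredConn (hG : IsGeodesicShearFree U h T) :
    IsParallel U (preferredConn h T) (tetradJ h T) := by
  refine F.isParallel_of_frame F.preferredConn_isWeylConnection (weylConn_isLocal h T _)
    fun x hx a b => F.ext_right hx fun c => ?_
  obtain ⟨g1, g2, g3, g4⟩ := hG x hx
  change gam h T 0 0 2 x = 0 at g1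
  change gam h T 2 0 2 x = 0 at g2
  change gam h T 1 1 3 x = 0 at g3
  change gam h T 3 1 3 x = 0 at g4
  have s := F.gam_self hx
  have k := F.gam_skew hx
  rw [preferredConn, covJ_weylConn]
  simp only [map_add, map_sub, map_smul, LinearMap.add_apply, LinearMap.sub_apply,
    LinearMap.smul_apply, smul_eq_mul, F.covJ_frame hx, F.tetradJ_frame hx, F.products x hx,
    F.tetradJ_skew, F.sharp_spec hx, map_zero, LinearMap.zero_apply, F.preferredForm_frame hx]
  fin_cases a <;> fin_cases b <;> fin_cases c <;>
    simp [nu, sJ, s, k _ 2 0, k _ 3 1, g1, g2, g3, g4] <;> ring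

end IsNullFrame

end

section

variable {M : Type*} [TopologicalSpace M] [ChartedSpace E4 M]

/-- The structure functions of the frame: `[e_a, e_b] = ∑ c_{ab}^e e_e`. -/
def strc (h : CForm2 M) (T : TetradData M) (a b e : Fin 4) : M → ℂ :=
  fun y => cf h T e y (cbracket (T.e a) (T.e b) y)

variable [IsManifold (𝓡 4) ∞ M]

namespace IsNullFrame

variable {U : Set M} {h : CForm2 M} {T : TetradData M} (F : IsNullFrame U h T)

omit [IsManifold (𝓡 4) ∞ M] in
theorem strc_skew (a b e : Fin 4) (x : M) : strc h T a b e x = - strc h T b a e x := by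
  simp only [strc, cbracket_swap (T.e a) (T.e b), Pi.neg_apply, map_neg]

include F

theorem strc_smooth {x : M} (hx : x ∈ U) (a b e : Fin 4) : FSmoothNear x (strc h T a b e) :=
  F.cf_smooth hx e ((F.frame_smooth x hx a).cbracket (F.frame_smooth x hx b))

theorem cbracket_frame {x : M} (hx : x ∈ U) (a b : Fin 4) :
    cbracket (T.e a) (T.e b) x = ∑ e, strc h T a b e x • T.e e x :=
  F.expand_cf hx _

theorem strc_eq {x : M} (hx : x ∈ U) (a b e : Fin 4) :
    strc h T a b e x = ∑ d, nu d e * (gam h T a b d x - gam h T b a d x) := by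
  have he := F.frame_smooth x hx
  rw [strc, ← F.leviCivita_isWeylConnection.torsion_free x hx _ _ (he a) (he b), cf_apply]
  simp only [gam, ev, F.symm x (T.e _ x), map_sub, LinearMap.sub_apply]

/-- The commutator of the frame derivations. -/
theorem frame_commutator {x : M} (hx : x ∈ U) (a b : Fin 4) {φ : M → ℂ} (hφ : FSmoothNear x φ) :
    ddir (T.e a) (ddir (T.e b) φ) x - ddir (T.e b) (ddir (T.e a) φ) x
      = ∑ e, strc h T a b e x * ddir (T.e e) φ x := by
  have he := F.frame_smooth x hx
  rw [← F.ddir_cbracket hx (he a) (he b) hφ, ddir, F.cbracket_frame hx]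
  change dL φ x _ = _
  simp only [map_sum, map_smul, smul_eq_mul]
  rfl

theorem frame_bracket_bracket {x : M} (hx : x ∈ U) (a b c f : Fin 4) :
    cf h T f x (cbracket (T.e a) (cbracket (T.e b) (T.e c)) x)
      = ddir (T.e a) (strc h T b c f) x + ∑ d, strc h T b c d x * strc h T a d f x := by
  have he := F.frame_smooth x hx
  have hs := F.strc_smooth hx b c
  have h1 : ∀ᶠ y in 𝓝 x, cbracket (T.e b) (T.e c) y = (((fun y => strc h T b c 0 y • T.e 0 y)
      + (fun y => strc h T b c 1 y • T.e 1 y)) + ((fun y => strc h T b c 2 y • T.e 2 y)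
      + (fun y => strc h T b c 3 y • T.e 3 y)) : CField M) y := by
    filter_upwards [F.eventually_mem hx] with y hy
    rw [F.cbracket_frame hy, Fin.sum_univ_four]
    simp only [Pi.add_apply]
    abel
  have sm := fun d => VSmoothNear.smul (hs d) (he d)
  rw [cbracket_congr (X := T.e a) (Filter.Eventually.of_forall fun _ => rfl) h1,
    cbracket_add_right ((sm 0).add (sm 1)) ((sm 2).add (sm 3)), cbracket_add_right (sm 0) (sm 1),
    cbracket_add_right (sm 2) (sm 3), cbracket_smul_right (hs 0) (he 0),
    cbracket_smul_right (hs 1) (he 1), cbracket_smul_right (hs 2) (he 2),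
    cbracket_smul_right (hs 3) (he 3)]
  simp only [map_add, map_smul, F.cf_frame hx, smul_eq_mul, Fin.sum_univ_four]
  fin_cases f <;> simp [strc] <;> ring

theorem frame_jacobi {x : M} (hx : x ∈ U) (a b c f : Fin 4) :
    (ddir (T.e a) (strc h T b c f) x + ∑ d, strc h T b c d x * strc h T a d f x)
      + (ddir (T.e b) (strc h T c a f) x + ∑ d, strc h T c a d x * strc h T b d f x)
      + (ddir (T.e c) (strc h T a b f) x + ∑ d, strc h T a b d x * strc h T c d f x) = 0 := by
  have he := F.frame_smooth x hx
  have hJ := cbracket_jacobi (he a) (he b) (he c)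
  have e1 : cbracket (T.e b) (cbracket (T.e a) (T.e c)) x
      = - cbracket (T.e b) (cbracket (T.e c) (T.e a)) x := by
    have hc := cbracket_smul_right (X := T.e b) (.const x (-1)) ((he c).cbracket (he a))
    have hn : ddir (T.e b) (fun _ => (-1 : ℂ)) x = 0 := by simp [ddir, dC_const]
    rw [hn, zero_smul, zero_add, neg_one_smul] at hc
    rw [← hc, cbracket_swap (T.e a)]
    congr 1
    ext1 y
    simp
  simp only [← F.frame_bracket_bracket hx]
  rw [hJ, e1, map_add, map_neg, map_neg]
  ring

/-- `d² = 0` on 1-forms, in the frame. -/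
theorem d_d_eq_zero {α : Fin 4 → M → ℂ} {G : Fin 4 → Fin 4 → M → ℂ}
    (hα : ∀ x ∈ U, ∀ a, FSmoothNear x (α a))
    (hG : ∀ x ∈ U, ∀ a b, G a b x = ddir (T.e a) (α b) x - ddir (T.e b) (α a) x
      - ∑ e, strc h T a b e x * α e x) {x : M} (hx : x ∈ U) (a b c : Fin 4) :
    (ddir (T.e a) (G b c) x - ∑ e, strc h T a b e x * G e c x)
      + (ddir (T.e b) (G c a) x - ∑ e, strc h T b c e x * G e a x)
      + (ddir (T.e c) (G a b) x - ∑ e, strc h T c a e x * G e b x) = 0 := by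
  have he := F.frame_smooth x hx
  have hd := fun a b => F.ddir_smooth hx (he a) (hα x hx b)
  have hs := F.strc_smooth hx
  have hp := fun a b e => FSmoothNear.mul (hs a b e) (hα x hx e)
  have key : ∀ a b c, ddir (T.e a) (G b c) x = ddir (T.e a) (ddir (T.e b) (α c)) x
      - ddir (T.e a) (ddir (T.e c) (α b)) x - ∑ e, (strc h T b c e x * ddir (T.e a) (α e) x
      + α e x * ddir (T.e a) (strc h T b c e) x) := by
    intro a b c
    have : G b c =ᶠ[𝓝 x] fun y => ddir (T.e b) (α c) y - ddir (T.e c) (α b) y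
        - ∑ e, strc h T b c e y * α e y := by
      filter_upwards [F.eventually_mem hx] with y hy using hG y hy b c
    rw [ddir, dC_congr this, dC_sub ((hd b c).sub (hd c b)) (.sum fun e _ => hp b c e),
      dC_sub (hd b c) (hd c b), dC_sum fun e _ => hp b c e]
    simp only [dC_mul (hs _ _ _) (hα x hx _)]
    rfl
  have c1 := F.frame_commutator hx a b (hα x hx c)
  have c2 := F.frame_commutator hx b c (hα x hx a)
  have c3 := F.frame_commutator hx c a (hα x hx b)
  have J := F.frame_jacobi hx a b c
  have J0 := J 0
  have J1 := J 1
  have J2 := J 2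
  have J3 := J 3
  simp only [key, hG x hx]
  simp only [Fin.sum_univ_four] at *
  have k := fun d c e => strc_skew (h := h) (T := T) d c e x
  simp only [k 0 a, k 1 a, k 2 a, k 3 a, k 0 b, k 1 b, k 2 b, k 3 b, k 0 c, k 1 c, k 2 c, k 3 c]
  linear_combination c1 + c2 + c3 - α 0 x * J0 - α 1 x * J1 - α 2 x * J2 - α 3 x * J3

end IsNullFrame

end

section

variable {M : Type*} [TopologicalSpace M] [ChartedSpace E4 M]

theorem ddir_mul_sub_mul {x : M} (X : CField M) {α β γ δ ρ : M → ℂ}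
    (hα : FSmoothNear x α) (hβ : FSmoothNear x β) (hγ : FSmoothNear x γ) (hδ : FSmoothNear x δ)
    (hρ : FSmoothNear x ρ) :
    ddir X (fun y => ρ y + (α y * β y - γ y * δ y)) x = ddir X ρ x
      + (α x * ddir X β x + β x * ddir X α x
        - (γ x * ddir X δ x + δ x * ddir X γ x)) := by
  simp only [ddir]
  rw [dC_add hρ ((hα.mul hβ).sub (hγ.mul hδ)), dC_sub (hα.mul hβ) (hγ.mul hδ), dC_mul hα hβ,
    dC_mul hγ hδ]

variable [IsManifold (𝓡 4) ∞ M]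

theorem riem_def (h : CForm2 M) (T : TetradData M) (a b c d : Fin 4) (x : M) :
    riem h T a b c d x = h x (leviCivita h (T.e a) (leviCivita h (T.e b) (T.e c)) x
      - leviCivita h (T.e b) (leviCivita h (T.e a) (T.e c)) x
      - leviCivita h (cbracket (T.e a) (T.e b)) (T.e c) x) (T.e d x) := rfl

namespace IsNullFrame

variable {U : Set M} {h : CForm2 M} {T : TetradData M} (F : IsNullFrame U h T)

include F

theorem riem_smooth {x : M} (hx : x ∈ U) (a b c d : Fin 4) : FSmoothNear x (riem h T a b c d) := by
  have he := F.frame_smooth x hx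
  have s := F.leviCivita_isWeylConnection.smooth x hx
  exact F.smooth x _ _ (((s _ _ (he a) (s _ _ (he b) (he c))).sub
    (s _ _ (he b) (s _ _ (he a) (he c)))).sub (s _ _ ((he a).cbracket (he b)) (he c))) (he d)

/-- The curvature in terms of the connection coefficients. -/
theorem riem_eq {x : M} (hx : x ∈ U) (a b c d : Fin 4) : riem h T a b c d x
    = ddir (T.e a) (gam h T b c d) x - ddir (T.e b) (gam h T a c d) x
      - (∑ e, ∑ f, nu e f * (gam h T b c e x * gam h T a d f x
        - gam h T a c e x * gam h T b d f x))
      - ∑ e, strc h T a b e x * gam h T e c d x := by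
  have he := F.frame_smooth x hx
  have L := F.leviCivita_isWeylConnection
  have m : ∀ a b, h x (leviCivita h (T.e a) (leviCivita h (T.e b) (T.e c)) x) (T.e d x)
      = ddir (T.e a) (gam h T b c d) x
        - ∑ e, ∑ f, nu e f * (gam h T b c e x * gam h T a d f x) := fun a b => by
    have m := L.metric x hx _ _ _ (he a) (F.leviCivita_frame_smooth hx b c) (he d)
    rw [LinearMap.zero_apply] at m
    have e1 : h x (leviCivita h (T.e b) (T.e c) x) (leviCivita h (T.e a) (T.e d) x)
        = ∑ e, ∑ f, nu e f * (gam h T b c e x * gam h T a d f x) := by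
      conv_lhs => rw [F.expand x hx (leviCivita h (T.e b) (T.e c) x)]
      simp only [map_sum, map_smul, LinearMap.sum_apply, LinearMap.smul_apply, smul_eq_mul, gam,
        ev, F.symm x (T.e _ x), mul_assoc]
    simp only [gam] at e1 ⊢
    linear_combination -e1 - m
  have hb : leviCivita h (cbracket (T.e a) (T.e b)) (T.e c) x
      = ∑ e, strc h T a b e x • leviCivita h (T.e e) (T.e c) x := by
    have e1 : ∀ᶠ y in 𝓝 x, cbracket (T.e a) (T.e b) y
        = (fun y => ∑ e, strc h T a b e y • T.e e y) y := by
      filter_upwards [F.eventually_mem hx] with y hy using F.cbracket_frame hy a b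
    rw [leviCivita_isLocal h x _ _ _ _ e1 (Filter.Eventually.of_forall fun _ => rfl),
      L.sum_left hx (he c) fun e _ => .smul (F.strc_smooth hx a b e) (he e)]
    exact Finset.sum_congr rfl fun e _ =>
      L.smul_left x hx _ _ _ (F.strc_smooth hx a b e) (he e) (he c)
  rw [riem_def, map_sub, map_sub, LinearMap.sub_apply, LinearMap.sub_apply, m a b, m b a, hb]
  simp only [map_sum, map_smul, LinearMap.sum_apply, LinearMap.smul_apply, smul_eq_mul, mul_sub,
    Finset.sum_sub_distrib]
  simp only [gam, ev]
  ring

theorem riem_skew_left {x : M} (hx : x ∈ U) (a b c d : Fin 4) :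
    riem h T a b c d x = - riem h T b a c d x := by
  simp only [F.riem_eq hx, strc_skew a b, Finset.sum_sub_distrib, mul_sub, neg_mul,
    Finset.sum_neg_distrib]
  ring

theorem riem_skew_right {x : M} (hx : x ∈ U) (a b c d : Fin 4) :
    riem h T a b c d x = - riem h T a b d c x := by
  have e : ∀ a b, ddir (T.e a) (gam h T b d c) x = - ddir (T.e a) (gam h T b c d) x := by
    intro a b
    have : gam h T b d c =ᶠ[𝓝 x] fun y => - gam h T b c d y := by
      filter_upwards [F.eventually_mem hx] with y hy using F.gam_skew hy b d c
    rw [ddir, dC_congr this, dC_neg (F.gam_smooth hx b c d), ddir]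
  have q : ∀ a b, ∑ e, ∑ f, nu e f * (gam h T b d e x * gam h T a c f x)
      = ∑ e, ∑ f, nu e f * (gam h T a c e x * gam h T b d f x) := fun a b => by
    rw [Finset.sum_comm]
    refine Finset.sum_congr rfl fun f _ => Finset.sum_congr rfl fun e _ => ?_
    rw [nu_symm e f]
    ring
  have g : ∑ e, strc h T a b e x * gam h T e d c x
      = - ∑ e, strc h T a b e x * gam h T e c d x := by
    rw [← Finset.sum_neg_distrib]
    exact Finset.sum_congr rfl fun e _ => by rw [F.gam_skew hx e d c]; ring
  simp only [F.riem_eq hx, Finset.sum_sub_distrib, mul_sub, e, g, q]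
  ring

theorem riem_bianchi {x : M} (hx : x ∈ U) (a b c d : Fin 4) :
    riem h T a b c d x + riem h T b c a d x + riem h T c a b d x = 0 := by
  have he := F.frame_smooth x hx
  have L := F.leviCivita_isWeylConnection
  have key : ∀ a b c, leviCivita h (T.e a) (leviCivita h (T.e b) (T.e c)) x
      - leviCivita h (T.e a) (leviCivita h (T.e c) (T.e b)) x
      - leviCivita h (cbracket (T.e b) (T.e c)) (T.e a) x
      = cbracket (T.e a) (cbracket (T.e b) (T.e c)) x := by
    intro a b c
    have e1 : ∀ᶠ y in 𝓝 x, leviCivita h (T.e b) (T.e c) y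
        = (leviCivita h (T.e c) (T.e b) + cbracket (T.e b) (T.e c)) y := by
      filter_upwards [F.eventually_mem hx] with y hy
      rw [Pi.add_apply, ← L.torsion_free y hy _ _ (F.frame_smooth y hy b) (F.frame_smooth y hy c)]
      abel
    rw [leviCivita_isLocal h x _ _ _ _ (Filter.Eventually.of_forall fun _ => rfl) e1,
      L.add_right x hx _ _ _ (he a) (F.leviCivita_frame_smooth hx c b) ((he b).cbracket (he c)),
      ← L.torsion_free x hx _ _ (he a) ((he b).cbracket (he c))]
    abel
  have J : cbracket (T.e a) (cbracket (T.e b) (T.e c)) x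
      + cbracket (T.e b) (cbracket (T.e c) (T.e a)) x
      + cbracket (T.e c) (cbracket (T.e a) (T.e b)) x = 0 := by
    have hf : ∀ f, cf h T f x (cbracket (T.e a) (cbracket (T.e b) (T.e c)) x
        + cbracket (T.e b) (cbracket (T.e c) (T.e a)) x
        + cbracket (T.e c) (cbracket (T.e a) (T.e b)) x) = 0 := fun f => by
      rw [map_add, map_add, F.frame_bracket_bracket hx, F.frame_bracket_bracket hx,
        F.frame_bracket_bracket hx, F.frame_jacobi hx]
    rw [F.expand_cf hx (cbracket _ _ x + _ + _)]
    simp only [hf, zero_smul, Finset.sum_const_zero]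
  rw [← key, ← key, ← key] at J
  have := congrArg (fun v => h x v (T.e d x)) J
  simp only [map_add, map_sub, map_zero, LinearMap.add_apply, LinearMap.sub_apply,
    LinearMap.zero_apply] at this
  simp only [riem_def, map_sub, LinearMap.sub_apply]
  linear_combination this

theorem riem_pair {x : M} (hx : x ∈ U) (a b c d : Fin 4) :
    riem h T a b c d x = riem h T c d a b x := by
  have B := F.riem_bianchi hx
  have l := F.riem_skew_left hx
  have r := F.riem_skew_right hx
  linear_combination (1 / 2) * (B b c a d + B c a d b + B a d b c + B d b c a - r b c a d
    - r c a b d - r a d c b - r d b a c - l b a d c + r a b d c - l d c a b - r c d b a)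

/-! ### The curvature of the self-dual connection -/

/-- The coefficients `γ_{a01} - γ_{a23}`. -/
def gamC (h : CForm2 M) (T : TetradData M) (a : Fin 4) : M → ℂ :=
  fun y => gam h T a 0 1 y - gam h T a 2 3 y

theorem gamC_smooth {x : M} (hx : x ∈ U) (a : Fin 4) : FSmoothNear x (gamC h T a) :=
  (F.gam_smooth hx a 0 1).sub (F.gam_smooth hx a 2 3)

theorem riem_A {x : M} (hx : x ∈ U) (a b : Fin 4) : riem h T a b 0 2 x
    = ddir (T.e a) (gam h T b 0 2) x - ddir (T.e b) (gam h T a 0 2) x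
      - ∑ e, strc h T a b e x * gam h T e 0 2 x
      - (gamC h T a x * gam h T b 0 2 x - gamC h T b x * gam h T a 0 2 x) := by
  have s := F.gam_self hx
  have k := F.gam_skew hx
  rw [F.riem_eq hx]
  simp [Fin.sum_univ_four, nu, s, gamC, k _ 2 0]
  ring

theorem riem_B {x : M} (hx : x ∈ U) (a b : Fin 4) : riem h T a b 1 3 x
    = ddir (T.e a) (gam h T b 1 3) x - ddir (T.e b) (gam h T a 1 3) x
      - ∑ e, strc h T a b e x * gam h T e 1 3 x
      + (gamC h T a x * gam h T b 1 3 x - gamC h T b x * gam h T a 1 3 x) := by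
  have s := F.gam_self hx
  have k := F.gam_skew hx
  rw [F.riem_eq hx]
  simp [Fin.sum_univ_four, nu, s, gamC, k _ 1 0, k _ 3 2, k _ 3 1]
  ring

theorem riem_C {x : M} (hx : x ∈ U) (a b : Fin 4) :
    riem h T a b 0 1 x - riem h T a b 2 3 x
    = ddir (T.e a) (gamC h T b) x - ddir (T.e b) (gamC h T a) x
      - ∑ e, strc h T a b e x * gamC h T e x
      - 2 * (gam h T a 0 2 x * gam h T b 1 3 x - gam h T b 0 2 x * gam h T a 1 3 x) := by
  have s := F.gam_self hx
  have k := F.gam_skew hx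
  have e : ∀ a b, ddir (T.e a) (gamC h T b) x
      = ddir (T.e a) (gam h T b 0 1) x - ddir (T.e a) (gam h T b 2 3) x := fun a b =>
    dC_sub (F.gam_smooth hx b 0 1) (F.gam_smooth hx b 2 3) _
  rw [F.riem_eq hx, F.riem_eq hx, e, e]
  simp [Fin.sum_univ_four, nu, s, gamC, k _ 1 0, k _ 3 2, k _ 2 0, k _ 3 1, k _ 2 1, k _ 3 0]
  ring

/-- The second Bianchi identity for the components `R_{ab02}`. -/
theorem bianchi_A {x : M} (hx : x ∈ U) (a b c : Fin 4) :
    (ddir (T.e a) (riem h T b c 0 2) x - ∑ e, strc h T a b e x * riem h T e c 0 2 x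
        + (riem h T a b 0 1 x - riem h T a b 2 3 x) * gam h T c 0 2 x
        - gamC h T a x * riem h T b c 0 2 x)
      + (ddir (T.e b) (riem h T c a 0 2) x - ∑ e, strc h T b c e x * riem h T e a 0 2 x
        + (riem h T b c 0 1 x - riem h T b c 2 3 x) * gam h T a 0 2 x
        - gamC h T b x * riem h T c a 0 2 x)
      + (ddir (T.e c) (riem h T a b 0 2) x - ∑ e, strc h T c a e x * riem h T e b 0 2 x
        + (riem h T c a 0 1 x - riem h T c a 2 3 x) * gam h T b 0 2 x
        - gamC h T c x * riem h T a b 0 2 x) = 0 := by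
  have gs := fun a => F.gam_smooth hx a 0 2
  have cs := F.gamC_smooth hx
  have D := F.d_d_eq_zero (α := fun a => gam h T a 0 2)
    (G := fun a b y => riem h T a b 0 2 y + (gamC h T a y * gam h T b 0 2 y
      - gamC h T b y * gam h T a 0 2 y)) (fun x hx a => F.gam_smooth hx a 0 2)
    (fun x hx a b => by rw [F.riem_A hx]; ring) hx a b c
  have m := fun a b c => ddir_mul_sub_mul (T.e a) (cs b) (gs c) (cs c) (gs b)
    (F.riem_smooth hx b c 0 2)
  simp only [m] at D
  have A1 := F.riem_A hx a b
  have A2 := F.riem_A hx b c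
  have A3 := F.riem_A hx c a
  have C1 := F.riem_C hx a b
  have C2 := F.riem_C hx b c
  have C3 := F.riem_C hx c a
  simp only [Fin.sum_univ_four] at *
  linear_combination D + gam h T c 0 2 x * C1 + gam h T a 0 2 x * C2 + gam h T b 0 2 x * C3
    - gamC h T c x * A1 - gamC h T a x * A2 - gamC h T b x * A3

/-- The second Bianchi identity for the components `R_{ab13}`. -/
theorem bianchi_B {x : M} (hx : x ∈ U) (a b c : Fin 4) :
    (ddir (T.e a) (riem h T b c 1 3) x - ∑ e, strc h T a b e x * riem h T e c 1 3 x
        - (riem h T a b 0 1 x - riem h T a b 2 3 x) * gam h T c 1 3 x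
        + gamC h T a x * riem h T b c 1 3 x)
      + (ddir (T.e b) (riem h T c a 1 3) x - ∑ e, strc h T b c e x * riem h T e a 1 3 x
        - (riem h T b c 0 1 x - riem h T b c 2 3 x) * gam h T a 1 3 x
        + gamC h T b x * riem h T c a 1 3 x)
      + (ddir (T.e c) (riem h T a b 1 3) x - ∑ e, strc h T c a e x * riem h T e b 1 3 x
        - (riem h T c a 0 1 x - riem h T c a 2 3 x) * gam h T b 1 3 x
        + gamC h T c x * riem h T a b 1 3 x) = 0 := by
  have gs := fun a => F.gam_smooth hx a 1 3
  have cs := F.gamC_smooth hx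
  have D := F.d_d_eq_zero (α := fun a => gam h T a 1 3)
    (G := fun a b y => riem h T a b 1 3 y + (gamC h T b y * gam h T a 1 3 y
      - gamC h T a y * gam h T b 1 3 y)) (fun x hx a => F.gam_smooth hx a 1 3)
    (fun x hx a b => by rw [F.riem_B hx]; ring) hx a b c
  have m := fun a b c => ddir_mul_sub_mul (T.e a) (cs c) (gs b) (cs b) (gs c)
    (F.riem_smooth hx b c 1 3)
  simp only [m] at D
  have A1 := F.riem_B hx a b
  have A2 := F.riem_B hx b c
  have A3 := F.riem_B hx c a
  have C1 := F.riem_C hx a b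
  have C2 := F.riem_C hx b c
  have C3 := F.riem_C hx c a
  simp only [Fin.sum_univ_four] at *
  linear_combination D - gam h T c 1 3 x * C1 - gam h T a 1 3 x * C2 - gam h T b 1 3 x * C3
    + gamC h T c x * A1 + gamC h T a x * A2 + gamC h T b x * A3

end IsNullFrame

end

section

/-- Algebraic form of the curvature of an Einstein metric of Petrov type D: the components of the
curvature of the self-dual connection. -/
theorem typeD_components (R : Fin 4 → Fin 4 → Fin 4 → Fin 4 → ℂ) (Λ : ℂ)
    (l : ∀ a b c d, R a b c d = - R b a c d) (r : ∀ a b c d, R a b c d = - R a b d c)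
    (p : ∀ a b c d, R a b c d = R c d a b)
    (B : ∀ a b c d, R a b c d + R b c a d + R c a b d = 0)
    (hE : ∀ a b, ∑ c, ∑ d, nu c d * R a c b d = Λ * nu a b)
    (h1 : R 0 2 0 1 = 0) (h3 : R 0 1 3 1 = 0) (h4 : R 3 1 3 1 = 0) :
    (R 0 1 0 2 = 0 ∧ R 0 3 0 2 = 0 ∧ R 1 2 0 2 = 0 ∧ R 2 3 0 2 = 0 ∧ R 1 3 0 2 = - R 0 2 3 1) ∧
    (R 0 1 1 3 = 0 ∧ R 0 2 1 3 = - R 0 2 3 1 ∧ R 0 3 1 3 = 0 ∧ R 1 2 1 3 = 0 ∧ R 1 3 1 3 = 0 ∧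
      R 2 3 1 3 = 0) ∧
    R 0 1 0 1 - R 0 1 2 3 = 2 * R 0 2 3 1 - Λ ∧ R 2 3 0 1 - R 2 3 2 3 = - (2 * R 0 2 3 1 - Λ) ∧
    R 0 2 0 1 - R 0 2 2 3 = 0 ∧ R 1 3 0 1 - R 1 3 2 3 = 0 ∧
    R 0 3 0 1 - R 0 3 2 3 = 0 ∧ R 1 2 0 1 - R 1 2 2 3 = 0 := by
  have zl : ∀ a c d, R a a c d = 0 := fun a c d => self_eq_neg.1 (l a a c d)
  have zr : ∀ a c d, R c d a a = 0 := fun a c d => self_eq_neg.1 (r c d a a)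
  have e00 := hE 0 0
  have e11 := hE 1 1
  have e22 := hE 2 2
  have e33 := hE 3 3
  have e01 := hE 0 1
  have e23 := hE 2 3
  have e02 := hE 0 2
  have e03 := hE 0 3
  have e12 := hE 1 2
  have e13 := hE 1 3
  have b := B 0 1 2 3
  simp [Fin.sum_univ_four, nu, zl, zr, l 1 0, l 2 0, l 3 0, l 2 1, l 3 1, l 3 2, r _ _ 1 0,
    r _ _ 2 0, r _ _ 3 0, r _ _ 2 1, r _ _ 3 1, r _ _ 3 2, p 0 2 0 1, p 0 3 0 1, p 0 3 0 2,
    p 1 2 0 1, p 1 2 0 2, p 1 2 0 3, p 1 3 0 1, p 1 3 0 2, p 1 3 0 3, p 1 3 1 2, p 2 3 0 1,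
    p 2 3 0 2, p 2 3 0 3, p 2 3 1 2, p 2 3 1 3] at *
  exact ⟨⟨h1, e00, e22, by linear_combination -e02 - h1⟩,
    ⟨h3, e33, e11, h4, by linear_combination e13 - h3⟩, by linear_combination -e01 - b,
    by linear_combination b - e23, by linear_combination 2 * h1 + e02,
    by linear_combination 2 * h3 - e13, by linear_combination -e03, by linear_combination e12⟩

/-- Components of a self-dual 2-form in the null frame. -/
def sdA : Fin 4 → Fin 4 → ℂ := ![![0, 0, 0, 0], ![0, 0, 0, 1], ![0, 0, 0, 0], ![0, -1, 0, 0]]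

/-- Components of a self-dual 2-form in the null frame. -/
def sdB : Fin 4 → Fin 4 → ℂ := ![![0, 0, 1, 0], ![0, 0, 0, 0], ![-1, 0, 0, 0], ![0, 0, 0, 0]]

/-- Components of a self-dual 2-form in the null frame. -/
def sdC : Fin 4 → Fin 4 → ℂ := ![![0, 1, 0, 0], ![-1, 0, 0, 0], ![0, 0, 0, -1], ![0, 0, 1, 0]]

variable {M : Type*} [TopologicalSpace M] [ChartedSpace E4 M] [IsManifold (𝓡 4) ∞ M]

theorem weyl_of_isEinstein {U : Set M} {h : CForm2 M} {T : TetradData M} {Λ : ℝ}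
    (hE : IsEinstein U h T Λ) {x : M} (hx : x ∈ U) (a b c d : Fin 4) : weyl h T a b c d x
      = riem h T a b c d x - Λ / 3 * (nu a c * nu b d - nu a d * nu b c) := by
  have hs : scal h T x = 4 * Λ := by
    simp only [scal, hE x hx]
    simp [Fin.sum_univ_four, nu]
    ring
  simp only [weyl, hs, hE x hx]
  ring

namespace IsNullFrame

variable {U : Set M} {h : CForm2 M} {T : TetradData M} (F : IsNullFrame U h T)

include F

theorem psi2_smooth {Λ : ℝ} (hE : IsEinstein U h T Λ) {x : M} (hx : x ∈ U) :
    FSmoothNear x (Psi2 h T) := by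
  refine ((F.riem_smooth hx 0 2 3 1).sub (.const x (Λ / 3 * (nu 0 3 * nu 2 1 - nu 0 1 * nu 2 3))
    )).congr ?_
  filter_upwards [F.eventually_mem hx] with y hy using (weyl_of_isEinstein hE hy 0 2 3 1).symm

theorem typeD_riem {Λ : ℝ} (hE : IsEinstein U h T Λ) (hD : IsTypeD U h T) {x : M} (hx : x ∈ U)
    (a b : Fin 4) : riem h T a b 0 2 x = sdA a b * -(Psi2 h T x + Λ / 3) ∧
      riem h T a b 1 3 x = sdB a b * -(Psi2 h T x + Λ / 3) ∧
      riem h T a b 0 1 x - riem h T a b 2 3 x = sdC a b * (2 * Psi2 h T x - Λ / 3) := by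
  obtain ⟨h0, h1, -, h3, h4⟩ := hD x hx
  have h2 : Psi2 h T x = _ := weyl_of_isEinstein hE hx 0 2 3 1
  rw [Psi0, weyl_of_isEinstein hE hx] at h0
  rw [Psi1, weyl_of_isEinstein hE hx] at h1
  rw [Psi3, weyl_of_isEinstein hE hx] at h3
  rw [Psi4, weyl_of_isEinstein hE hx] at h4
  simp [nu] at h0 h1 h2 h3 h4
  have l := F.riem_skew_left hx
  obtain ⟨⟨a1, a2, a3, a4, a5⟩, ⟨b1, b2, b3, b4, b5, b6⟩, c1, c2, c3, c4, c5, c6⟩ :=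
    typeD_components (fun a b c d => riem h T a b c d x) Λ l (F.riem_skew_right hx)
      (F.riem_pair hx) (F.riem_bianchi hx) (fun a b => hE x hx a b) h1 h3 h4
  have z : ∀ a c d, riem h T a a c d x = 0 := fun a c d => self_eq_neg.1 (l a a c d)
  rw [h2]
  fin_cases a <;> fin_cases b <;>
    simp only [sdA, sdB, sdC, Fin.zero_eta, Fin.mk_one, Fin.reduceFinMk, l 1 0, l 2 0, l 3 0,
      l 2 1, l 3 1, l 3 2, z, a1, a2, a3, a4, a5, h0, b1, b2, b3, b4, b5, b6] <;>
    simp <;> grind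

end IsNullFrame

end

section

variable {M : Type*} [TopologicalSpace M] [ChartedSpace E4 M] [IsManifold (𝓡 4) ∞ M]

namespace IsNullFrame

variable {U : Set M} {h : CForm2 M} {T : TetradData M} (F : IsNullFrame U h T)

include F

theorem ddir_typeD_riem {Λ : ℝ} (hE : IsEinstein U h T Λ) (hD : IsTypeD U h T) {x : M}
    (hx : x ∈ U) (X : CField M) (b c : Fin 4) :
    ddir X (riem h T b c 0 2) x = - sdA b c * ddir X (Psi2 h T) x ∧
      ddir X (riem h T b c 1 3) x = - sdB b c * ddir X (Psi2 h T) x := by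
  have hs := F.psi2_smooth hE hx
  have key : ∀ s : ℂ, dC (fun y => s * -(Psi2 h T y + Λ / 3)) x (X x)
      = - s * dC (Psi2 h T) x (X x) := fun s => by
    rw [dC_const_mul s (hs.add (.const x _)).neg, dC_neg (hs.add (.const x _)),
      dC_add hs (.const x _), dC_const]
    ring
  have eA : riem h T b c 0 2 =ᶠ[𝓝 x] fun y => sdA b c * -(Psi2 h T y + Λ / 3) := by
    filter_upwards [F.eventually_mem hx] with y hy using (F.typeD_riem hE hD hy b c).1
  have eB : riem h T b c 1 3 =ᶠ[𝓝 x] fun y => sdB b c * -(Psi2 h T y + Λ / 3) := by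
    filter_upwards [F.eventually_mem hx] with y hy using (F.typeD_riem hE hD hy b c).2.1
  exact ⟨(dC_congr eA _).trans (key _), (dC_congr eB _).trans (key _)⟩

/-- The Bianchi identities of an Einstein metric of Petrov type D. -/
theorem typeD_bianchi {Λ : ℝ} (hE : IsEinstein U h T Λ) (hD : IsTypeD U h T) {x : M}
    (hx : x ∈ U) : IsGeodesicShearFree {x} h T ∧ ∀ a,
      ddir (T.e a) (Psi2 h T) x = 3 * Psi2 h T x * preferredForm h T x (T.e a x) := by
  have s := F.gam_self hx
  have k := F.gam_skew hx
  have hP : Psi2 h T x ≠ 0 := (hD x hx).2.2.1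
  have bA := F.bianchi_A hx
  have bB := F.bianchi_B hx
  simp only [fun X b c => (F.ddir_typeD_riem hE hD hx X b c).1,
    fun a b => (F.typeD_riem hE hD hx a b).1, fun a b => (F.typeD_riem hE hD hx a b).2.2,
    F.strc_eq hx] at bA
  simp only [fun X b c => (F.ddir_typeD_riem hE hD hx X b c).2,
    fun a b => (F.typeD_riem hE hD hx a b).2.1, fun a b => (F.typeD_riem hE hD hx a b).2.2,
    F.strc_eq hx] at bB
  have A012 := bA 0 1 2
  have A013 := bA 0 1 3
  have A023 := bA 0 2 3
  have A123 := bA 1 2 3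
  have B012 := bB 0 1 2
  have B013 := bB 0 1 3
  have B023 := bB 0 2 3
  have B123 := bB 1 2 3
  simp [Fin.sum_univ_four, nu, sdA, sdB, sdC, s, gamC, k _ 1 0, k _ 2 0, k _ 3 0, k _ 2 1, k _ 3 1,
    k _ 3 2] at A012 A013 A023 A123 B012 B013 B023 B123
  have zero_of : ∀ t : ℂ, 3 * Psi2 h T x * t = 0 → t = 0 := fun t ht => by
    simpa [hP] using ht
  refine ⟨?_, fun a => ?_⟩
  · rintro _ rfl
    refine ⟨zero_of _ ?_, zero_of _ ?_, zero_of _ ?_, zero_of _ ?_⟩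
    · change _ * gam h T 0 0 2 _ = 0
      linear_combination -A023
    · change _ * gam h T 2 0 2 _ = 0
      linear_combination A012
    · change _ * gam h T 1 1 3 _ = 0
      linear_combination B123
    · change _ * gam h T 3 1 3 _ = 0
      linear_combination -B013
  · rw [F.preferredForm_frame hx]
    fin_cases a <;> simp
    · linear_combination -A013
    · linear_combination B012
    · linear_combination A123
    · linear_combination -B023

end IsNullFrame

end

section

variable {M : Type*} [TopologicalSpace M] [ChartedSpace E4 M]

theorem fSmoothNear_of_contMDiffOn {V : Set M} (hV : IsOpen V) {φ : M → ℂ}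
    (hφ : ContMDiffOn (𝓡 4) 𝓘(ℝ, ℂ) ∞ φ V) {x : M} (hx : x ∈ V) : FSmoothNear x φ := by
  filter_upwards [hV.mem_nhds hx] with y hy using hφ.contMDiffAt (hV.mem_nhds hy)

theorem dC_exp {x : M} {φ : M → ℂ} (hφ : FSmoothNear x φ) (v : CTangent x) :
    dC (fun y => Complex.exp (φ y)) x v = Complex.exp (φ x) * dC φ x v := by
  have hd := ((Complex.hasDerivAt_exp (φ x)).hasFDerivAt.restrictScalars ℝ).hasMFDerivAt.comp x
    hφ.mdifferentiableAt.hasMFDerivAt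
  have key : ∀ w : TangentSpace (𝓡 4) x, mvfderiv (𝓡 4) (fun y => Complex.exp (φ y)) x w
      = Complex.exp (φ x) * mvfderiv (𝓡 4) φ x w := by
    intro w
    change (mfderiv (𝓡 4) 𝓘(ℝ, ℂ) (Complex.exp ∘ φ) x) w = _
    rw [hd.mfderiv, mul_comm]
    rfl
  simp only [dC_eq, key]
  ring

theorem exists_log_branch {U : Set M} (hU : IsOpen U) {ψ : M → ℂ}
    (hψ : ∀ x ∈ U, FSmoothNear x ψ) {x : M} (hx : x ∈ U) (h0 : ψ x ≠ 0) :
    ∃ (V : Set M) (L : M → ℂ), IsOpen V ∧ x ∈ V ∧ V ⊆ U ∧ ContMDiffOn (𝓡 4) 𝓘(ℝ, ℂ) ∞ L V ∧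
      ∀ y ∈ V, Complex.exp (3 * L y) = ψ y := by
  have hs : ∀ y ∈ U, ContMDiffAt (𝓡 4) 𝓘(ℝ, ℂ) ∞ (fun z => ψ z / ψ x) y := fun y hy => by
    have := ((hψ y hy).mul (.const y (ψ x)⁻¹)).self_of_nhds
    simpa only [div_eq_mul_inv] using this
  have hc : ContinuousOn (fun z => ψ z / ψ x) U := fun y hy =>
    (hs y hy).continuousAt.continuousWithinAt
  refine ⟨U ∩ (fun z => ψ z / ψ x) ⁻¹' Complex.slitPlane,
    fun y => 1 / 3 * (Complex.log (ψ y / ψ x) + Complex.log (ψ x)),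
    hc.isOpen_inter_preimage hU Complex.isOpen_slitPlane, ⟨hx, by simp [div_self h0]⟩,
    Set.inter_subset_left, fun y hy => ?_, fun y hy => ?_⟩
  · have hl : ContMDiffAt 𝓘(ℝ, ℂ) 𝓘(ℝ, ℂ) ∞ (fun z => 1 / 3 * (Complex.log z + Complex.log (ψ x)))
        (ψ y / ψ x) :=
      ((contDiffAt_const (c := (1 / 3 : ℂ))).mul
        (((Complex.contDiffAt_log hy.2).restrict_scalars ℝ).add contDiffAt_const)).contMDiffAt
    exact (hl.comp y (hs y hy.1)).contMDiffWithinAt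
  · have hne : ψ y / ψ x ≠ 0 := Complex.slitPlane_ne_zero hy.2
    rw [← mul_assoc, mul_one_div_cancel (by norm_num), one_mul, Complex.exp_add,
      Complex.exp_log hne, Complex.exp_log h0, div_mul_cancel₀ _ h0]

variable [IsManifold (𝓡 4) ∞ M]

theorem isParallel_mono {U V : Set M} (hVU : V ⊆ U) {D : CConn M} {J : CEnd M}
    (hJ : IsParallel U D J) : IsParallel V D J := fun x hx => hJ x (hVU hx)

namespace IsNullFrame

variable {U : Set M} {h : CForm2 M} {T : TetradData M} (F : IsNullFrame U h T)

include F

theorem isIntegrable_of_isGeodesicShearFree (hG : IsGeodesicShearFree U h T) :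
    IsIntegrable U (tetradJ h T) :=
  F.preferredConn_isWeylConnection.isIntegrable (fun _ hx => F.tetradJ_sq hx)
    (fun _ hx _ => F.tetradJ_smooth hx) (F.isParallel_preferredConn hG)

theorem isGeodesicShearFree_of_typeD {Λ : ℝ} (hE : IsEinstein U h T Λ) (hD : IsTypeD U h T) :
    IsGeodesicShearFree U h T := fun x hx => (F.typeD_bianchi hE hD hx).1 x rfl

theorem dC_psi2 {Λ : ℝ} (hE : IsEinstein U h T Λ) (hD : IsTypeD U h T) {x : M} (hx : x ∈ U)
    (v : CTangent x) : dC (Psi2 h T) x v = 3 * Psi2 h T x * preferredForm h T x v := by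
  have : dL (Psi2 h T) x = (3 * Psi2 h T x) • preferredForm h T x :=
    F.linear_ext hx fun a => (F.typeD_bianchi hE hD hx).2 a
  exact LinearMap.congr_fun this v

theorem preferredForm_eq_dC {Λ : ℝ} (hE : IsEinstein U h T Λ) (hD : IsTypeD U h T) {V : Set M}
    {L : M → ℂ} (hV : IsOpen V) (hVU : V ⊆ U) (hL : ContMDiffOn (𝓡 4) 𝓘(ℝ, ℂ) ∞ L V)
    (he : ∀ y ∈ V, Complex.exp (3 * L y) = Psi2 h T y) {y : M} (hy : y ∈ V) (v : CTangent y) :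
    preferredForm h T y v = dC L y v := by
  have hLy := fSmoothNear_of_contMDiffOn hV hL hy
  have e : (fun z => Complex.exp (3 * L z)) =ᶠ[𝓝 y] Psi2 h T := by
    filter_upwards [hV.mem_nhds hy] with z hz using he z hz
  have d := dC_congr e v
  rw [dC_exp ((FSmoothNear.const y 3).mul hLy), dC_const_mul 3 hLy, F.dC_psi2 hE hD (hVU hy),
    he y hy] at d
  have hP : 3 * Psi2 h T y ≠ 0 := mul_ne_zero (by norm_num) (hD y (hVU hy)).2.2.1
  exact mul_left_cancel₀ hP (by linear_combination -d)

theorem preferredForm_isClosed {Λ : ℝ} (hE : IsEinstein U h T Λ) (hD : IsTypeD U h T) :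
    IsClosedForm1 U (preferredForm h T) := by
  refine ⟨fun x hx X hX => F.preferredForm_smooth hx hX, fun x hx X Y hX hY => ?_⟩
  obtain ⟨V, L, hV, hxV, hVU, hL, he⟩ := exists_log_branch F.isOpen
    (fun y hy => F.psi2_smooth hE hy) hx (hD x hx).2.2.1
  have e : ∀ Z : CField M, (fun y => preferredForm h T y (Z y)) =ᶠ[𝓝 x] ddir Z L := fun Z => by
    filter_upwards [hV.mem_nhds hxV] with y hy
    exact F.preferredForm_eq_dC hE hD hV hVU hL he hy _
  have c := F.ddir_cbracket hx hX hY (fSmoothNear_of_contMDiffOn hV hL hxV)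
  rw [ddir, ddir, dC_congr (e Y), dC_congr (e X), F.preferredForm_eq_dC hE hD hV hVU hL he hxV]
  change ddir X (ddir Y L) x - ddir Y (ddir X L) x - ddir (cbracket X Y) L x = 0
  rw [c, sub_self]

theorem dC_conformal {Λ : ℝ} (hE : IsEinstein U h T Λ) (hD : IsTypeD U h T) {V : Set M}
    {Φ : M → ℂ} (hV : IsOpen V) (hVU : V ⊆ U) (hΦ : ContMDiffOn (𝓡 4) 𝓘(ℝ, ℂ) ∞ Φ V)
    (he : ∀ y ∈ V, Φ y ^ 3 = Psi2 h T y ^ 2) {y : M} (hy : y ∈ V) :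
    Φ y ≠ 0 ∧ ∀ v, dC Φ y v = 2 * preferredForm h T y v * Φ y := by
  have hP := (hD y (hVU hy)).2.2.1
  have h3 := he y hy
  have h0 : Φ y ≠ 0 := by
    intro h0
    rw [h0] at h3
    exact hP (by simpa using h3.symm)
  refine ⟨h0, fun v => ?_⟩
  have hΦy := fSmoothNear_of_contMDiffOn hV hΦ hy
  have hs := F.psi2_smooth hE (hVU hy)
  have e : (fun z => Φ z * (Φ z * Φ z)) =ᶠ[𝓝 y] fun z => Psi2 h T z * Psi2 h T z := by
    filter_upwards [hV.mem_nhds hy] with z hz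
    linear_combination he z hz
  have d := dC_congr e v
  rw [dC_mul hΦy (hΦy.mul hΦy), dC_mul hΦy hΦy, dC_mul hs hs, F.dC_psi2 hE hD (hVU hy)] at d
  have hk : 3 * Φ y ^ 2 ≠ 0 := mul_ne_zero (by norm_num) (pow_ne_zero _ h0)
  refine mul_left_cancel₀ hk ?_
  linear_combination d - 6 * preferredForm h T y v * h3

theorem isKahler_rescale {V : Set M} {Φ : M → ℂ} {D : CConn M} (hV : IsOpen V) (hVU : V ⊆ U)
    (hΦ : ContMDiffOn (𝓡 4) 𝓘(ℝ, ℂ) ∞ Φ V) (h0 : ∀ y ∈ V, Φ y ≠ 0)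
    (hD : IsLeviCivita V (rescale Φ h) D) (hP : IsParallel V D (tetradJ h T)) :
    IsKahler V (rescale Φ h) (tetradJ h T) where
  metric_symm x _ u v := congrArg (Φ x * ·) (F.symm x u v)
  metric_nondegenerate x hx u hu := F.ext_right (hVU hx) fun a => by
    have := hu (T.e a x)
    change Φ x * h x u (T.e a x) = 0 at this
    simpa [h0 x hx] using this
  metric_smooth x hx X Y hX hY :=
    (fSmoothNear_of_contMDiffOn hV hΦ hx).mul (F.smooth x X Y hX hY)
  almost_complex x hx := F.tetradJ_sq (hVU hx)
  almost_complex_smooth x hx _ := F.tetradJ_smooth (hVU hx)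
  compatible x hx u v := congrArg (Φ x * ·) (F.tetradJ_compatible (hVU hx) u v)
  integrable := IsWeylConnection.isIntegrable hD (fun _ hx => F.tetradJ_sq (hVU hx))
    (fun _ hx _ => F.tetradJ_smooth (hVU hx)) hP
  closed := IsWeylConnection.isClosedForm2 hD (fun _ _ => rfl)
    (fun x u v => congrArg (Φ x * ·) (F.symm x u v))
    (fun x u v => by
      change Φ x * h x _ _ = -(Φ x * h x _ _)
      rw [F.tetradJ_skew, mul_neg])
    (fun _ hx _ => F.tetradJ_smooth (hVU hx)) hP

end IsNullFrame

end

end Spacetime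

end

theorem mainTheorem4 {M : Type*} [TopologicalSpace M] [ChartedSpace Spacetime.E4 M]
    [IsManifold (𝓡 4) ∞ M]
    (g₀ : (x : M) → LinearMap.BilinForm ℝ (TangentSpace (𝓡 4) x))
    (hg₀ : Spacetime.IsLorentzMetric g₀)
    (U : Set M) (hU : IsOpen U)
    (T : Spacetime.TetradData M) (hT : Spacetime.IsNullTetrad U g₀ T)
    (g : Spacetime.CForm2 M) (hg : g = Spacetime.cmetric g₀)
    (J : Spacetime.CEnd M) (hJ : J = Spacetime.tetradJ g T)
    (f : Spacetime.CForm1 M) (hf : f = Spacetime.preferredForm g T)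
    (D : Spacetime.CConn M) (hD : D = Spacetime.preferredConn g T) :
    -- `f`, `D` is the unique Weyl connection compatible with `J`
    (Spacetime.IsWeylConnection U g f D ∧
      (∀ x ∈ U, ∀ X, Spacetime.VSmoothNear x X → Spacetime.divJ g T D J X x = 0) ∧
      ∀ (f₁ : Spacetime.CForm1 M) (D₁ : Spacetime.CConn M),
        Spacetime.IsWeylConnection U g f₁ D₁ →
        (∀ x ∈ U, ∀ X, Spacetime.VSmoothNear x X → Spacetime.divJ g T D₁ J X x = 0) →
        (∀ x ∈ U, f₁ x = f x) ∧
        ∀ x ∈ U, ∀ X Y, Spacetime.VSmoothNear x X → Spacetime.VSmoothNear x Y →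
          D₁ X Y x = D X Y x) ∧
    -- geodesic shear-free null directions
    (Spacetime.IsGeodesicShearFree U g T →
      Spacetime.IsParallel U D J ∧ Spacetime.IsIntegrable U J) ∧
    -- Einstein spacetimes of Petrov type D
    (∀ Λ : ℝ, Spacetime.IsEinstein U g T Λ → Spacetime.IsTypeD U g T →
      Spacetime.IsGeodesicShearFree U g T ∧
      Spacetime.IsParallel U D J ∧ Spacetime.IsIntegrable U J ∧
      -- `f = d log Ψ₂^{1/3}` and `f` is closed
      (∀ x ∈ U, ∃ (V : Set M) (L : M → ℂ), IsOpen V ∧ x ∈ V ∧ V ⊆ U ∧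
        ContMDiffOn (𝓡 4) 𝓘(ℝ, ℂ) ∞ L V ∧
        ∀ y ∈ V, Complex.exp (3 * L y) = Spacetime.Psi2 g T y) ∧
      (∀ (V : Set M) (L : M → ℂ), IsOpen V → V ⊆ U → ContMDiffOn (𝓡 4) 𝓘(ℝ, ℂ) ∞ L V →
        (∀ y ∈ V, Complex.exp (3 * L y) = Spacetime.Psi2 g T y) →
        ∀ y ∈ V, ∀ v, f y v = Spacetime.dC L y v) ∧
      Spacetime.IsClosedForm1 U f ∧
      -- the metric `Ψ₂^{2/3} g` is Kähler, with Levi-Civita connection `D`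
      (∀ (V : Set M) (Φ : M → ℂ), IsOpen V → V ⊆ U → ContMDiffOn (𝓡 4) 𝓘(ℝ, ℂ) ∞ Φ V →
        (∀ y ∈ V, Φ y ^ 3 = Spacetime.Psi2 g T y ^ 2) →
        Spacetime.IsLeviCivita V (Spacetime.rescale Φ g) D ∧
        Spacetime.IsKahler V (Spacetime.rescale Φ g) J)) := by
  subst hg hJ hf hD
  have F := hg₀.isNullFrame hU hT
  have W := F.preferredConn_isWeylConnection
  refine ⟨⟨W, fun x hx X hX => ?_, fun f₁ D₁ W₁ hd => ?_⟩, fun hG => ?_, fun Λ hE hD => ?_⟩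
  · rw [Spacetime.preferredConn, F.divJ_weylConn hx hX, sub_self, mul_zero]
  · have hf : ∀ x ∈ U, f₁ x = Spacetime.preferredForm (Spacetime.cmetric g₀) T x := fun x hx =>
      F.preferred_unique W₁ hd hx
    refine ⟨hf, fun x hx X Y hX hY => ?_⟩
    rw [F.eq_weylConn W₁ hx hX hY, Spacetime.preferredConn, Spacetime.weylConn_apply,
      Spacetime.weylConn_apply, Spacetime.sharp, Spacetime.sharp, hf x hx]
  · exact ⟨F.isParallel_preferredConn hG, F.isIntegrable_of_isGeodesicShearFree hG⟩
  · have hG := F.isGeodesicShearFree_of_typeD hE hD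
    have hP := F.isParallel_preferredConn hG
    refine ⟨hG, hP, F.isIntegrable_of_isGeodesicShearFree hG,
      fun x hx => Spacetime.exists_log_branch hU (fun y hy => F.psi2_smooth hE hy) hx
        (hD x hx).2.2.1,
      fun V L hV hVU hL he y hy v => F.preferredForm_eq_dC hE hD hV hVU hL he hy v,
      F.preferredForm_isClosed hE hD, fun V Φ hV hVU hΦ he => ?_⟩
    have hdΦ := fun y hy => F.dC_conformal hE hD hV hVU hΦ he (y := y) hy
    have hLC := W.isLeviCivita_rescale hVU
      (fun x hx => Spacetime.fSmoothNear_of_contMDiffOn hV hΦ hx) F.smooth fun x hx => (hdΦ x hx).2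
    exact ⟨hLC, F.isKahler_rescale hV hVU hΦ (fun y hy => (hdΦ y hy).1) hLC
      (Spacetime.isParallel_mono hVU hP)⟩
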